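/- Let $n\ge 1$, $\mu\ge 0$, $p,q>1$, $R>0$, and write $B_r=\{x\in\mathbb{R}^n:|x|\le r\}$. Consider \[ \begin{cases} \partial_t^2u-\Delta u+\partial_tu=|v|^p, & t>0,\ x\in\mathbb{R}^n,\\ \partial_t^2v-\Delta v+b(t)\,\partial_tv=|u|^q, & t>0,\ x\in\mathbb{R}^n,\\ (u,\partial_tu,v,\partial_tv)(0,x)=\varepsilon(u_0,u_1,v_0,v_1)(x), & x\in\mathbb{R}^n, \end{cases} \qquad b(t)=\frac{\mu}{1+t}, \] where $(u_0,u_1,v_0,v_1)\in\big(W^{1,1}_{\mathrm{loc}}(\mathbb{R}^n)\times L^1_{\mathrm{loc}}(\mathbb{R}^n)\big)^2$ and each of $u_0,u_1,v_0,v_1$ is nonnegative, not identically zero, and supported in $B_R$. For $0<T\le\infty$, a weak solution on $[0,T)$ is a pair $(u,v)$ with $u,v\in C([0,T),W^{1,1}_{\mathrm{loc}}(\mathbb{R}^n))\cap C^1([0,T),L^1_{\mathrm{loc}}(\mathbb{R}^n))$, $u\in L^q_{\mathrm{loc}}([0,T)\times\mathbb{R}^n)$, $v\in L^p_{\mathrm{loc}}([0,T)\times\mathbb{R}^n)$,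 such that $u(t,\cdot),v(t,\cdot)$ are supported in $B_{R+t}$ for all $t\in(0,T)$, $u(0,\cdot)=\varepsilon u_0$, $v(0,\cdot)=\varepsilon v_0$, and for all $\phi,\psi\in C_0^\infty([0,T)\times\mathbb{R}^n)$ and all $t\in(0,T)$ \[ \int_0^t\!\!\int_{\mathbb{R}^n}\big(-\partial_su\,\partial_s\phi+\partial_su\,\phi+\nabla u\cdot\nabla\phi\big)\,dx\,ds+\int_{\mathbb{R}^n}\partial_tu(t,x)\phi(t,x)\,dx=\varepsilon\int_{\mathbb{R}^n}u_1(x)\phi(0,x)\,dx+\int_0^t\!\!\int_{\mathbb{R}^n}|v|^p\phi\,dx\,ds, \] \[ \int_0^t\!\!\int_{\mathbb{R}^n}\big(-\partial_sv\,\partial_s\psi+\nabla v\cdot\nabla\psi+b(s)\,\partial_sv\,\psi\big)\,dx\,ds+\int_{\mathbb{R}^n}\partial_tv(t,x)\psi(t,x)\,dx=\varepsilon\int_{\mathbb{R}^n}v_1(x)\psi(0,x)\,dx+\int_0^t\!\!\int_{\mathbb{R}^n}|u|^q\psi\,dx\,ds. \] Assume, with $[y]_+=\max\{y,0\}$, that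 \[ \Gamma(n,p,q,\mu)=\max\left\{\frac{2+p^{-1}}{pq-1}-\frac{n+\mu-1}{2},\ \frac{q+2}{pq-1}-n+[1-\mu]_+,\ \frac{2p+1}{pq-1}-n\right\}>0. \] Then there exist $\varepsilon_0>0$ and $C>0$, depending only on $n,\mu,p,q,R,u_0,u_1,v_0,v_1$ and in particular not on $\varepsilon$, such that for every $\varepsilon\in(0,\varepsilon_0]$ every weak solution blows up in finite time, with upper bound $C\varepsilon^{-1/\Gamma(n,p,q,\mu)}$ for its lifespan; that is, if a weak solution exists on $[0,T)$, where $0<T\le\infty$, then $T<\infty$ and \[ T\le C\,\varepsilon^{-1/\Gamma(n,p,q,\mu)}. \] -/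

import Mathlib

open MeasureTheory Set Filter Topology
open scoped ContDiff Gradient

namespace Nakao

/-- The Euclidean space `ℝⁿ`. -/
abbrev E (n : ℕ) : Type := EuclideanSpace ℝ (Fin n)

/-- The time interval `[0, T)`, where `T` may be `∞`. -/
def timeDomain (T : EReal) : Set ℝ := {t : ℝ | 0 ≤ t ∧ (t : EReal) < T}

/-- `g` is the weak (distributional) gradient of `w`, both being locally integrable. -/
def HasWeakGradient {n : ℕ} (w : E n → ℝ) (g : E n → E n) : Prop :=
  LocallyIntegrable w ∧ LocallyIntegrable g ∧
    ∀ φ : E n → ℝ, ContDiff ℝ ∞ φ → HasCompactSupport φ →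
      ∫ x, w x • ∇ φ x = - ∫ x, φ x • g x

/-- The space `W^{1,1}_loc(ℝⁿ)`. -/
def MemW11loc {n : ℕ} (w : E n → ℝ) : Prop := ∃ g : E n → E n, HasWeakGradient w g

/-- The function vanishes (almost everywhere) outside the closed ball of radius `r` around `0`,
that is, its essential support is contained in that ball. -/
def SupportedInBall {n : ℕ} (r : ℝ) (w : E n → ℝ) : Prop := ∀ᵐ x, r < ‖x‖ → w x = 0

/-- `f ∈ C([0, T), L¹_loc(ℝⁿ))`, for a scalar or vector valued `f`. -/
def ContL1loc {n : ℕ} {F : Type*} [NormedAddCommGroup F] (T : EReal) (f : ℝ → E n → F) : Prop :=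
  (∀ t ∈ timeDomain T, LocallyIntegrable (f t)) ∧
    ∀ t ∈ timeDomain T, ∀ K : Set (E n), IsCompact K →
      Tendsto (fun s => ∫ x in K, ‖f s x - f t x‖) (𝓝[timeDomain T] t) (𝓝 0)

/-- `w ∈ C¹([0, T), L¹_loc(ℝⁿ))` with time derivative `wt` (one-sided at the time `0`). -/
def C1L1loc {n : ℕ} (T : EReal) (w wt : ℝ → E n → ℝ) : Prop :=
  ContL1loc T w ∧ ContL1loc T wt ∧
    ∀ t ∈ timeDomain T, ∀ K : Set (E n), IsCompact K →
      Tendsto (fun s => ∫ x in K, |(w s x - w t x) / (s - t) - wt t x|)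
        (𝓝[timeDomain T \ {t}] t) (𝓝 0)

/-- `w ∈ C([0, T), W^{1,1}_loc(ℝⁿ))` with spatial weak gradient `g`. -/
def ContW11loc {n : ℕ} (T : EReal) (w : ℝ → E n → ℝ) (g : ℝ → E n → E n) : Prop :=
  (∀ t ∈ timeDomain T, HasWeakGradient (w t) (g t)) ∧ ContL1loc T w ∧ ContL1loc T g

/-- `w ∈ L^r_loc([0, T) × ℝⁿ)`. -/
def MemLrloc {n : ℕ} (T : EReal) (r : ℝ) (w : ℝ → E n → ℝ) : Prop :=
  ∀ K : Set (ℝ × E n), IsCompact K → K ⊆ timeDomain T ×ˢ univ →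
    MemLp (fun z : ℝ × E n => w z.1 z.2) (ENNReal.ofReal r) (volume.restrict K)

/-- Test functions `φ ∈ C_0^∞([0, T) × ℝⁿ)`. They need not vanish at the time `0`; a function that
is smooth up to the time `0` is given by a smooth extension of it to negative times. -/
def IsTestFunction {n : ℕ} (T : EReal) (φ : ℝ × E n → ℝ) : Prop :=
  ContDiff ℝ ∞ φ ∧ HasCompactSupport φ ∧ ∀ z ∈ tsupport φ, (z.1 : EReal) < T

/-- `w`, with time derivative `wt` and spatial gradient `g`, satisfies the integral form of
`∂ₜ² w - Δ w + b(t) ∂ₜ w = h` on `[0, T)` with `∂ₜ w (0, ·) = w₁`. -/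
def SatisfiesDampedWave {n : ℕ} (T : EReal) (b : ℝ → ℝ) (w₁ : E n → ℝ)
    (wt : ℝ → E n → ℝ) (g : ℝ → E n → E n) (h : ℝ → E n → ℝ) : Prop :=
  ∀ φ : ℝ × E n → ℝ, IsTestFunction T φ → ∀ t : ℝ, 0 < t → (t : EReal) < T →
    (∫ s in (0 : ℝ)..t, ∫ x, (-(wt s x * deriv (fun σ => φ (σ, x)) s)
        + inner ℝ (g s x) (∇ (fun y => φ (s, y)) x)
        + b s * wt s x * φ (s, x)))
      + ∫ x, wt t x * φ (t, x)
    = (∫ x, w₁ x * φ (0, x)) + ∫ s in (0 : ℝ)..t, ∫ x, h s x * φ (s, x)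

/-- `(u, v)` is a weak solution on `[0, T)` of
`∂ₜ² u - Δ u + ∂ₜ u = |v|^p`, `∂ₜ² v - Δ v + b(t) ∂ₜ v = |u|^q`
with data `(u, ∂ₜ u, v, ∂ₜ v)(0, ·) = ε (u₀, u₁, v₀, v₁)`, the data being supported in the closed
ball of radius `R`. -/
def IsWeakSolution {n : ℕ} (p q : ℝ) (b : ℝ → ℝ) (R ε : ℝ) (u₀ u₁ v₀ v₁ : E n → ℝ)
    (T : EReal) (u v : ℝ → E n → ℝ) : Prop :=
  ∃ (ut vt : ℝ → E n → ℝ) (gu gv : ℝ → E n → E n),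
    ContW11loc T u gu ∧ C1L1loc T u ut ∧ MemLrloc T q u ∧
    ContW11loc T v gv ∧ C1L1loc T v vt ∧ MemLrloc T p v ∧
    (∀ t : ℝ, 0 < t → (t : EReal) < T →
      SupportedInBall (R + t) (u t) ∧ SupportedInBall (R + t) (v t)) ∧
    (∀ᵐ x, u 0 x = ε * u₀ x) ∧ (∀ᵐ x, v 0 x = ε * v₀ x) ∧
    SatisfiesDampedWave T (fun _ => 1) (fun x => ε * u₁ x) ut gu (fun s x => |v s x| ^ p) ∧
    SatisfiesDampedWave T b (fun x => ε * v₁ x) vt gv (fun s x => |u s x| ^ q)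

/-- The function is nonnegative and not zero (as elements of `L¹_loc`). -/
def NonnegNontrivial {n : ℕ} (w : E n → ℝ) : Prop :=
  (∀ᵐ x, 0 ≤ w x) ∧ ¬ (∀ᵐ x, w x = 0)

/-- The quantity `Γ(n, p, q, μ)`. -/
noncomputable def Gam (n : ℕ) (p q μ : ℝ) : ℝ :=
  max (max ((2 + p⁻¹) / (p * q - 1) - ((n : ℝ) + μ - 1) / 2)
    ((q + 2) / (p * q - 1) - (n : ℝ) + max (1 - μ) 0))
    ((2 * p + 1) / (p * q - 1) - (n : ℝ))

end Nakao

/-! The core is the inequality `ε ≤ C * τ ^ (-Gam n p q μ)` for every real `1 ≤ τ < T`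
(`exists_gam_bound`). Since `Gam` is positive, solving it for `τ` bounds the lifespan. It comes from
a test function argument on `[0, τ]`, one estimate for each of the three entries of the maximum.

Average both equations in space. By finite speed of propagation a cutoff `χ` that is `1` on a
slightly larger ball does not see the Laplacian, so the averages satisfy scalar equations `F'' + b
F' = H` with `H` the integral of the nonlinearity. Test these in time with `(1 + s) ^ m ζ(s / τ) ^
(j + 2)`, where `m = 0` for `u` and `m = min μ 1` for `v`. With these weights the damping leaves
only a constant `c ≥ 0`, so after one integration by parts the error lives on `[τ / 2, τ]`. It has
size `τ ^ (-1)` for `u` and `τ ^ (m - 2)` for `v` (`exists_solution_functional_bound`). Hölder's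
inequality in space and time bounds each error by the forcing of the other equation
(`exists_average_rpow_le`). As `p q > 1`, the resulting cycle of inequalities closes and bounds both
the data and the forcing by powers of `τ` (`exists_coupled_decay`). The data of `u` give the entry
with `2 p + 1`, those of `v` the entry with `q + 2`.

The remaining entry compares the upper bound for the `|v| ^ p` forcing with a lower bound of order
`ε ^ p` (`exists_forcing_lower_bound`). For that, pair `v` with the positive radial solution `Φ` of
`ΔΦ = Φ`. The pairing satisfies `F'' + μ / (1 + t) F' ≥ F` and grows at least like `ε e ^ t (1 + t)
^ (-μ / 2)` (`exists_exp_lower_bound`). The norm of `Φ` on the light cone section is controlled by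
`exists_integral_radialEigenfunction_le`. Hölder's inequality cancels the exponentials and leaves a
power of `1 + t`. -/

namespace Nakao

/-! ### The modified Bessel series and its growth -/

/-- The coefficients of the entire function `besselSeries ν`. -/
noncomputable def besselCoeff (ν : ℝ) (k : ℕ) : ℝ :=
  ∏ j ∈ Finset.range k, (2 * ((j : ℝ) + 1) * (2 * j + ν))⁻¹

/-- The entire solution of `4 y f'' + 2 ν f' = f` with `f 0 = 1` (a modified Bessel function up to a
change of variables). For `ν = n`, the function `x ↦ f (‖x‖ ^ 2)` on `ℝⁿ` is an eigenfunction of the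
Laplacian with eigenvalue `1`. -/
noncomputable def besselSeries (ν y : ℝ) : ℝ := ∑' k : ℕ, besselCoeff ν k * y ^ k

lemma besselCoeff_succ (ν : ℝ) (k : ℕ) :
    besselCoeff ν (k + 1) = besselCoeff ν k * (2 * ((k : ℝ) + 1) * (2 * k + ν))⁻¹ := by
  simp [besselCoeff, Finset.prod_range_succ]

lemma besselCoeff_nonneg {ν : ℝ} (hν : 1 ≤ ν) (k : ℕ) : 0 ≤ besselCoeff ν k :=
  Finset.prod_nonneg fun j _ => by positivity

lemma besselCoeff_le {ν : ℝ} (hν : 1 ≤ ν) (k : ℕ) : besselCoeff ν k ≤ ((k.factorial : ℝ))⁻¹ := by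
  induction k with
  | zero => simp [besselCoeff]
  | succ k ih =>
    rw [besselCoeff_succ, Nat.factorial_succ, Nat.cast_mul, mul_inv _ (k.factorial : ℝ), mul_comm]
    refine mul_le_mul ?_ ih (besselCoeff_nonneg hν k) (by positivity)
    apply inv_anti₀ (by positivity)
    push_cast
    nlinarith [(Nat.cast_nonneg k : (0 : ℝ) ≤ k)]

/-- Both sides obey the same recursion in `k`. Read on the series, it says that differentiation
raises `ν` by `2` up to a factor, so the family is closed under derivatives; smoothness and the
differential equation both follow from this. -/
lemma besselCoeff_shift {ν : ℝ} (hν : 1 ≤ ν) (k : ℕ) :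
    ((k : ℝ) + 1) * besselCoeff ν (k + 1) = (2 * ν)⁻¹ * besselCoeff (ν + 2) k := by
  have hν0 : ν ≠ 0 := by positivity
  induction k with
  | zero => simp [besselCoeff]
  | succ k ih =>
    have h1 : (2 * ((k : ℝ) + 1 + 1) * (2 * (k + 1) + ν)) ≠ 0 := by positivity
    have h2 : (2 * ((k : ℝ) + 1) * (2 * k + (ν + 2))) ≠ 0 := by positivity
    have h3 : ((k : ℝ) + 1) ≠ 0 := by positivity
    rw [besselCoeff_succ, besselCoeff_succ (ν + 2), ← mul_assoc ((2 * ν)⁻¹), ← ih]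
    push_cast
    field_simp
    ring

lemma summable_besselCoeff_mul_pow {ν : ℝ} (hν : 1 ≤ ν) (y : ℝ) :
    Summable fun k : ℕ => besselCoeff ν k * y ^ k := by
  refine Summable.of_norm_bounded (Real.summable_pow_div_factorial |y|) fun k => ?_
  rw [norm_mul, norm_pow, Real.norm_eq_abs, Real.norm_eq_abs,
    abs_of_nonneg (besselCoeff_nonneg hν k), mul_comm, div_eq_mul_inv]
  gcongr
  exact besselCoeff_le hν k

lemma hasDerivAt_besselSeries {ν : ℝ} (hν : 1 ≤ ν) (y : ℝ) :
    HasDerivAt (besselSeries ν) ((2 * ν)⁻¹ * besselSeries (ν + 2) y) y := by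
  have key : HasDerivAt (fun z => ∑' k : ℕ, besselCoeff ν k * z ^ k)
      (∑' k : ℕ, besselCoeff ν k * (k * y ^ (k - 1))) y := by
    -- A ball around `0` that contains `y`; termwise differentiation needs a summable bound only
    -- there, and the shifted series at `M` supplies it.
    set M := |y| + 1
    have hsum : Summable fun k : ℕ => ‖besselCoeff ν k * (k * M ^ (k - 1))‖ := by
      rw [← summable_nat_add_iff 1]
      have := (summable_besselCoeff_mul_pow (ν := ν + 2) (by linarith) M).mul_left ((2 * ν)⁻¹)
      refine this.norm.congr fun k => ?_
      rw [← mul_assoc, ← besselCoeff_shift hν]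
      congr 1
      push_cast
      ring
    refine hasDerivAt_tsum_of_isPreconnected (t := Metric.ball 0 M) (y₀ := 0) hsum
      Metric.isOpen_ball (convex_ball 0 M).isPreconnected
      (g := fun k z => besselCoeff ν k * z ^ k)
      (fun k z _ => (hasDerivAt_pow k z).const_mul _) (fun k z hz => ?_) ?_
      (summable_besselCoeff_mul_pow hν 0) (mem_ball_zero_iff.2 (lt_add_one _))
    · simp only [norm_mul, norm_pow]
      have : ‖z‖ ≤ ‖M‖ := by
        have := mem_ball_zero_iff.1 hz
        exact this.le.trans (le_abs_self M)
      gcongr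
    · exact Metric.mem_ball_self (by positivity)
  have h2 : ∑' k : ℕ, besselCoeff ν k * (k * y ^ (k - 1)) = (2 * ν)⁻¹ * besselSeries (ν + 2) y := by
    rw [besselSeries, ← tsum_mul_left]
    have hs : Summable fun k : ℕ => besselCoeff ν (k + 1) * (((k + 1 : ℕ) : ℝ) * y ^ (k + 1 - 1)) := by
      have := (summable_besselCoeff_mul_pow (ν := ν + 2) (by linarith) y).mul_left ((2 * ν)⁻¹)
      refine this.congr fun k => ?_
      rw [← mul_assoc, ← besselCoeff_shift hν]
      push_cast
      ring
    have hs' : Summable fun k : ℕ => besselCoeff ν k * ((k : ℝ) * y ^ (k - 1)) :=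
      (summable_nat_add_iff (f := fun k : ℕ => besselCoeff ν k * ((k : ℝ) * y ^ (k - 1))) 1).1 hs
    rw [hs'.tsum_eq_zero_add]
    simp only [Nat.cast_zero, zero_mul, mul_zero, zero_add]
    refine tsum_congr fun k => ?_
    rw [← mul_assoc (2 * ν)⁻¹, ← besselCoeff_shift hν, Nat.add_sub_cancel]
    push_cast
    ring
  rw [h2] at key
  exact key

lemma contDiff_besselSeries {ν : ℝ} (hν : 1 ≤ ν) : ContDiff ℝ ∞ (besselSeries ν) := by
  rw [contDiff_infty]
  intro m
  induction m generalizing ν with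
  | zero =>
    exact contDiff_zero.2 (continuous_iff_continuousAt.2
      fun y => (hasDerivAt_besselSeries hν y).continuousAt)
  | succ m ih =>
    have hd : deriv (besselSeries ν) = fun y => (2 * ν)⁻¹ * besselSeries (ν + 2) y :=
      funext fun y => (hasDerivAt_besselSeries hν y).deriv
    have : ((m + 1 : ℕ) : WithTop ℕ∞) = (m : WithTop ℕ∞) + 1 := by push_cast; rfl
    rw [this, contDiff_succ_iff_deriv]
    refine ⟨fun y => (hasDerivAt_besselSeries hν y).differentiableAt, by simp, ?_⟩
    rw [hd]
    exact contDiff_const.mul (ih (by linarith))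

lemma besselSeries_ode {ν : ℝ} (hν : 1 ≤ ν) (y : ℝ) :
    4 * y * ((2 * ν)⁻¹ * ((2 * (ν + 2))⁻¹ * besselSeries (ν + 2 + 2) y))
      + 2 * ν * ((2 * ν)⁻¹ * besselSeries (ν + 2) y) = besselSeries ν y := by
  have hν0 : ν ≠ 0 := by positivity
  have s0 := summable_besselCoeff_mul_pow hν y
  have s2 := summable_besselCoeff_mul_pow (ν := ν + 2) (by linarith) y
  have s4 := summable_besselCoeff_mul_pow (ν := ν + 2 + 2) (by linarith) y
  rw [besselSeries, besselSeries, besselSeries, s0.tsum_eq_zero_add, s2.tsum_eq_zero_add,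
    ← tsum_mul_left, ← tsum_mul_left]
  rw [mul_inv_cancel_left₀ (by positivity), ← tsum_mul_left, add_left_comm]
  have s4' : Summable fun k : ℕ => 4 * y * ((2 * ν)⁻¹ * ((2 * (ν + 2))⁻¹ *
      (besselCoeff (ν + 2 + 2) k * y ^ k))) := ((s4.mul_left _).mul_left _).mul_left _
  rw [← s4'.tsum_add ((summable_nat_add_iff 1).2 s2)]
  refine congrArg₂ (· + ·) (by simp [besselCoeff]) ?_
  refine tsum_congr fun k => ?_
  have e1 := besselCoeff_shift hν k
  have e2 := besselCoeff_shift (ν := ν + 2) (by linarith) k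
  have e3 : besselCoeff (ν + 2) (k + 1) = besselCoeff (ν + 2) k *
      (2 * ((k : ℝ) + 1) * (2 * k + (ν + 2)))⁻¹ := besselCoeff_succ _ _
  have h3 : ((k : ℝ) + 1) ≠ 0 := by positivity
  have h4 : (2 * (k:ℝ) + (ν + 2)) ≠ 0 := by positivity
  have e1' : besselCoeff ν (k + 1) = ((k:ℝ) + 1)⁻¹ * ((2 * ν)⁻¹ * besselCoeff (ν + 2) k) := by
    rw [← e1, inv_mul_cancel_left₀ h3]
  have e0 : besselCoeff (ν + 2) k = besselCoeff (ν + 2) (k + 1) *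
      (2 * ((k : ℝ) + 1) * (2 * k + (ν + 2))) := by rw [e3]; field_simp
  calc 4 * y * ((2 * ν)⁻¹ * ((2 * (ν + 2))⁻¹ * (besselCoeff (ν + 2 + 2) k * y ^ k)))
        + besselCoeff (ν + 2) (k + 1) * y ^ (k + 1)
      = 4 * y * ((2 * ν)⁻¹ * (((2 * (ν + 2))⁻¹ * besselCoeff (ν + 2 + 2) k) * y ^ k))
        + besselCoeff (ν + 2) (k + 1) * y ^ (k + 1) := by ring
    _ = besselCoeff ν (k + 1) * y ^ (k + 1) := by
      rw [← e2, e1', e0]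
      field_simp
      ring

lemma one_le_besselSeries {ν y : ℝ} (hν : 1 ≤ ν) (hy : 0 ≤ y) : 1 ≤ besselSeries ν y := by
  have := (summable_besselCoeff_mul_pow hν y).sum_le_tsum (Finset.range 1)
    (fun k _ => mul_nonneg (besselCoeff_nonneg hν k) (pow_nonneg hy k))
  simpa [besselCoeff, besselSeries] using this

/-- With `Φ(r) = besselSeries ν (r ^ 2)` one has `Φ'' + (ν - 1) / r Φ' = Φ`. A first order
factorisation `Z = Φ' + k Φ` with integrating factor `W` makes `Z W` nonincreasing on `[1, ∞)`.
There `Φ ≤ Z` and `W ≥ e ^ (-r) r ^ ((ν - 1) / 2)`, which yields the Bessel asymptotics as an upper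
bound without any contour or Laplace method. -/
lemma exists_besselSeries_sq_le {ν : ℝ} (hν : 1 ≤ ν) :
    ∃ C, 0 < C ∧ ∀ r, 0 ≤ r →
      besselSeries ν (r ^ 2) ≤ C * (Real.exp r * (1 + r) ^ (-((ν - 1) / 2))) := by
  -- This value cancels the term `(ν - 1) ^ 2 / (4 r ^ 2)` in `(Z W)'`; everything left over is
  -- nonpositive.
  set κ := (ν - 1) ^ 2 / 8 with hκ
  set G : ℝ → ℝ := fun r => 2 * r * ((2 * ν)⁻¹ * besselSeries (ν + 2) (r ^ 2)) with hG
  set k : ℝ → ℝ := fun r => 1 + (ν - 1) / 2 * r⁻¹ + κ * (r ^ 2)⁻¹ with hk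
  set Z : ℝ → ℝ := fun r => G r + k r * besselSeries ν (r ^ 2) with hZ
  set W : ℝ → ℝ := fun r => Real.exp (-r + (ν - 1) / 2 * Real.log r + κ * r⁻¹) with hW
  have hκ0 : 0 ≤ κ := by positivity
  have dsq : ∀ r : ℝ, HasDerivAt (fun r : ℝ => r ^ 2) (2 * r) r := fun r => by
    simpa using hasDerivAt_pow 2 r
  have dΦ : ∀ r, HasDerivAt (fun r => besselSeries ν (r ^ 2)) (G r) r := fun r => by
    have := (hasDerivAt_besselSeries hν (r ^ 2)).comp r (dsq r)
    refine this.congr_deriv ?_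
    simp only [hG]; ring
  have dG : ∀ r, r ≠ 0 → HasDerivAt G (besselSeries ν (r ^ 2) - (ν - 1) * r⁻¹ * G r) r := by
    intro r hr
    have h1 := (hasDerivAt_besselSeries (ν := ν + 2) (by linarith) (r ^ 2)).comp r (dsq r)
    have h2 := ((hasDerivAt_id r).const_mul 2).mul (h1.const_mul (2 * ν)⁻¹)
    refine h2.congr_deriv ?_
    rw [← besselSeries_ode hν]
    simp only [hG, Function.comp, id]
    field_simp
    ring
  have dinv : ∀ r : ℝ, r ≠ 0 → HasDerivAt (fun r : ℝ => r⁻¹) (-(r ^ 2)⁻¹) r := fun r hr =>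
    hasDerivAt_inv hr
  have dk : ∀ r, r ≠ 0 → HasDerivAt k ((ν - 1) / 2 * (-(r ^ 2)⁻¹) + κ * (-(2 * r) / (r ^ 2) ^ 2)) r := by
    intro r hr
    have := (((dinv r hr).const_mul ((ν - 1) / 2)).const_add 1).add
      (((dsq r).inv (pow_ne_zero 2 hr)).const_mul κ)
    exact this
  have dW : ∀ r, r ≠ 0 → HasDerivAt W (W r * (-1 + (ν - 1) / 2 * r⁻¹ + κ * (-(r ^ 2)⁻¹))) r := by
    intro r hr
    exact ((((hasDerivAt_id r).neg).add ((Real.hasDerivAt_log hr).const_mul ((ν - 1) / 2))).add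
      ((dinv r hr).const_mul κ)).exp
  have dZW : ∀ r, 0 < r → HasDerivAt (fun r => Z r * W r) (W r * besselSeries ν (r ^ 2) *
      ((-2 * κ * r - κ ^ 2) / (r ^ 2) ^ 2 - (ν - 1) / 2 / r ^ 2)) r := by
    intro r hr
    have hr' := hr.ne'
    have := ((dG r hr').add ((dk r hr').mul (dΦ r))).mul (dW r hr')
    refine this.congr_deriv ?_
    simp only [Pi.add_apply, Pi.mul_apply, hk, hκ]
    field_simp
    ring
  have anti : AntitoneOn (fun r => Z r * W r) (Ici 1) := by
    refine antitoneOn_of_deriv_nonpos (convex_Ici 1) ?_ ?_ ?_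
    · exact fun r hr => (dZW r (lt_of_lt_of_le one_pos hr)).continuousAt.continuousWithinAt
    · intro r hr
      rw [interior_Ici] at hr
      exact (dZW r (one_pos.trans hr)).differentiableAt.differentiableWithinAt
    · intro r hr
      rw [interior_Ici] at hr
      have hr0 : 0 < r := one_pos.trans hr
      rw [(dZW r hr0).deriv]
      have : 0 ≤ W r * besselSeries ν (r ^ 2) :=
        mul_nonneg (Real.exp_pos _).le (zero_le_one.trans (one_le_besselSeries hν (sq_nonneg r)))
      have h2 : (-2 * κ * r - κ ^ 2) / (r ^ 2) ^ 2 - (ν - 1) / 2 / r ^ 2 ≤ 0 := by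
        have h3 : (-2 * κ * r - κ ^ 2) / (r ^ 2) ^ 2 ≤ 0 :=
          div_nonpos_of_nonpos_of_nonneg (by nlinarith [mul_nonneg hκ0 hr0.le]) (by positivity)
        have h4 : 0 ≤ (ν - 1) / 2 / r ^ 2 := by
          have : 0 ≤ ν - 1 := by linarith
          positivity
        linarith
      exact mul_nonpos_of_nonneg_of_nonpos this h2
  have hbig : ∀ r, 1 ≤ r → besselSeries ν (r ^ 2) ≤ Z 1 * W 1 * Real.exp r *
      r ^ (-((ν - 1) / 2)) := by
    intro r hr
    have hr0 : 0 < r := one_pos.trans_le hr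
    have h1 := anti (mem_Ici.2 le_rfl) (mem_Ici.2 hr) hr
    have hΦ0 := zero_le_one.trans (one_le_besselSeries hν (sq_nonneg r))
    have hk1 : 1 ≤ k r := by
      have : 0 ≤ ν - 1 := by linarith
      simp only [hk]
      have : 0 ≤ (ν - 1) / 2 * r⁻¹ := by positivity
      have : 0 ≤ κ * (r ^ 2)⁻¹ := by positivity
      linarith
    have hG0 : 0 ≤ G r := by
      have := zero_le_one.trans (one_le_besselSeries (ν := ν + 2) (by linarith) (sq_nonneg r))
      simp only [hG]; positivity
    have hZΦ : besselSeries ν (r ^ 2) ≤ Z r := by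
      simp only [hZ]; nlinarith
    have hWlow : Real.exp (-r) * r ^ ((ν - 1) / 2) ≤ W r := by
      rw [Real.rpow_def_of_pos hr0, ← Real.exp_add]
      apply Real.exp_le_exp.2
      have : 0 ≤ κ * r⁻¹ := by positivity
      linarith [mul_comm ((ν - 1) / 2) (Real.log r)]
    have h3 : besselSeries ν (r ^ 2) * (Real.exp (-r) * r ^ ((ν - 1) / 2)) ≤ Z 1 * W 1 :=
      (mul_le_mul hZΦ hWlow (by positivity) (hΦ0.trans hZΦ)).trans h1
    rw [Real.rpow_neg hr0.le]
    rw [Real.exp_neg] at h3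
    have hp := Real.rpow_pos_of_pos hr0 ((ν - 1) / 2)
    rw [← div_eq_mul_inv, le_div_iff₀ hp]
    calc besselSeries ν (r ^ 2) * r ^ ((ν - 1) / 2)
        = besselSeries ν (r ^ 2) * ((Real.exp r)⁻¹ * r ^ ((ν - 1) / 2)) * Real.exp r := by
          field_simp
      _ ≤ _ := by gcongr
  obtain ⟨M, hM⟩ := (isCompact_Icc (a := (0 : ℝ)) (b := 1)).exists_bound_of_continuousOn
    (f := fun r => besselSeries ν (r ^ 2)) (fun r _ => (dΦ r).continuousAt.continuousWithinAt)
  have hZ1 : 0 ≤ Z 1 * W 1 := by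
    have := hbig 1 le_rfl
    simp only [Real.one_rpow, mul_one] at this
    have h0 := zero_le_one.trans (one_le_besselSeries hν (sq_nonneg 1))
    exact nonneg_of_mul_nonneg_left (h0.trans this) (Real.exp_pos 1)
  have hβ : 0 ≤ (ν - 1) / 2 := by linarith
  -- The factor `2 ^ ((ν - 1) / 2)` pays for replacing `r` by `1 + r` when `1 ≤ r`, and for the
  -- decay of `(1 + r) ^ (-((ν - 1) / 2))` on `[0, 1]`.
  refine ⟨(|M| + Z 1 * W 1 + 1) * 2 ^ ((ν - 1) / 2), by positivity, fun r hr => ?_⟩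
  have hinv : (1 + r) ^ (-((ν - 1) / 2)) = ((1 + r) ^ ((ν - 1) / 2))⁻¹ :=
    Real.rpow_neg (by linarith) _
  rcases le_total r 1 with h | h
  · have h1 := (le_abs_self _).trans (hM r ⟨hr, h⟩)
    have h2 : (1 + r) ^ ((ν - 1) / 2) ≤ 2 ^ ((ν - 1) / 2) :=
      Real.rpow_le_rpow (by linarith) (by linarith) hβ
    have h3 : 1 ≤ 2 ^ ((ν - 1) / 2) * (1 + r) ^ (-((ν - 1) / 2)) := by
      rw [hinv, ← div_eq_mul_inv, one_le_div (by positivity)]; exact h2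
    have h4 : 1 ≤ Real.exp r := Real.one_le_exp hr
    calc besselSeries ν (r ^ 2) ≤ (|M| + Z 1 * W 1 + 1) * (1 * 1) := by
          linarith [le_abs_self M]
      _ ≤ (|M| + Z 1 * W 1 + 1) * ((2 ^ ((ν - 1) / 2) * (1 + r) ^ (-((ν - 1) / 2))) * Real.exp r) := by
          gcongr
      _ = _ := by ring
  · have hr0 : 0 < r := by linarith
    have h2 : r ^ (-((ν - 1) / 2)) ≤ 2 ^ ((ν - 1) / 2) * (1 + r) ^ (-((ν - 1) / 2)) := by
      rw [hinv, Real.rpow_neg hr, ← div_eq_mul_inv, le_div_iff₀ (by positivity),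
        inv_mul_le_iff₀ (by positivity), ← Real.mul_rpow hr (by norm_num)]
      exact Real.rpow_le_rpow (by linarith) (by linarith) hβ
    calc besselSeries ν (r ^ 2) ≤ Z 1 * W 1 * Real.exp r * r ^ (-((ν - 1) / 2)) := hbig r h
      _ ≤ (|M| + Z 1 * W 1 + 1) * Real.exp r * (2 ^ ((ν - 1) / 2) * (1 + r) ^ (-((ν - 1) / 2))) := by
          gcongr
          linarith [abs_nonneg M]
      _ = _ := by ring

/-! ### The Laplacian and its radial eigenfunction -/

/-- The Laplacian of a smooth function on `ℝⁿ`. -/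
noncomputable def lap {n : ℕ} (φ : E n → ℝ) (x : E n) : ℝ :=
  ∑ i, fderiv ℝ (fun y => fderiv ℝ φ y (EuclideanSpace.single i 1)) x (EuclideanSpace.single i 1)

lemma lap_congr {n : ℕ} {φ ψ : E n → ℝ} {x : E n} (h : φ =ᶠ[𝓝 x] ψ) : lap φ x = lap ψ x := by
  unfold lap
  refine Finset.sum_congr rfl fun i _ => ?_
  have : (fun y => fderiv ℝ φ y (EuclideanSpace.single i 1)) =ᶠ[𝓝 x]
      fun y => fderiv ℝ ψ y (EuclideanSpace.single i 1) := by
    filter_upwards [h.fderiv (𝕜 := ℝ)] with y hy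
    rw [hy]
  rw [this.fderiv_eq]

lemma lap_const {n : ℕ} (c : ℝ) (x : E n) : lap (fun _ : E n => c) x = 0 := by
  simp [lap]

/-- A positive radial eigenfunction of the Laplacian on `ℝⁿ` with eigenvalue `1`. -/
noncomputable def radialEigenfunction {n : ℕ} (x : E n) : ℝ := besselSeries n (‖x‖ ^ 2)

variable {n : ℕ}

lemma contDiff_radialEigenfunction (hn : 1 ≤ n) :
    ContDiff ℝ ∞ (radialEigenfunction : E n → ℝ) :=
  (contDiff_besselSeries (by exact_mod_cast hn)).comp (contDiff_norm_sq ℝ)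

lemma one_le_radialEigenfunction (hn : 1 ≤ n) (x : E n) : 1 ≤ radialEigenfunction x :=
  one_le_besselSeries (by exact_mod_cast hn) (sq_nonneg _)

lemma fderiv_besselSeries_norm_sq {ν : ℝ} (hν : 1 ≤ ν) (x : E n) (i : Fin n) :
    fderiv ℝ (fun y : E n => besselSeries ν (‖y‖ ^ 2)) x (EuclideanSpace.single i 1) =
      (2 * ν)⁻¹ * besselSeries (ν + 2) (‖x‖ ^ 2) * (2 * x i) := by
  have h := (hasDerivAt_besselSeries hν (‖x‖ ^ 2)).comp_hasFDerivAt x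
    (hasStrictFDerivAt_norm_sq x).hasFDerivAt
  have h' : HasFDerivAt (fun y : E n => besselSeries ν (‖y‖ ^ 2)) _ x := h
  rw [h'.fderiv]
  simp [EuclideanSpace.inner_single_right]

lemma lap_radialEigenfunction (hn : 1 ≤ n) (x : E n) :
    lap (radialEigenfunction : E n → ℝ) x = radialEigenfunction x := by
  have hν : (1 : ℝ) ≤ n := by exact_mod_cast hn
  have hν2 : (1 : ℝ) ≤ n + 2 := by linarith
  have key : ∀ i : Fin n, fderiv ℝ (fun y : E n => fderiv ℝ radialEigenfunction y
      (EuclideanSpace.single i 1)) x (EuclideanSpace.single i 1) =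
      (2 * (n : ℝ))⁻¹ * ((2 * ((n : ℝ) + 2))⁻¹ * besselSeries (n + 2 + 2) (‖x‖ ^ 2)) * 4 * (x i) ^ 2
        + 2 * ((2 * (n : ℝ))⁻¹ * besselSeries (n + 2) (‖x‖ ^ 2)) := by
    intro i
    have e : (fun y : E n => fderiv ℝ radialEigenfunction y (EuclideanSpace.single i 1)) =
        fun y => ((2 * (n : ℝ))⁻¹ * 2) * (besselSeries (n + 2) (‖y‖ ^ 2) * y i) := by
      funext y
      have := fderiv_besselSeries_norm_sq hν y i
      unfold radialEigenfunction
      rw [this]; ring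
    rw [e]
    have d1 : DifferentiableAt ℝ (fun y : E n => besselSeries ((n : ℝ) + 2) (‖y‖ ^ 2)) x :=
      (((contDiff_besselSeries hν2).comp (contDiff_norm_sq ℝ)).differentiable (by simp)) x
    have d2 : HasFDerivAt (fun y : E n => y i) (EuclideanSpace.proj i : E n →L[ℝ] ℝ) x :=
      (EuclideanSpace.proj i : E n →L[ℝ] ℝ).hasFDerivAt
    have d3 := (d1.hasFDerivAt.mul d2).const_mul ((2 * (n : ℝ))⁻¹ * 2)
    have d4 : HasFDerivAt (fun y : E n => ((2 * (n : ℝ))⁻¹ * 2) *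
      (besselSeries (n + 2) (‖y‖ ^ 2) * y i)) _ x := d3
    rw [d4.fderiv]
    simp only [smul_apply, add_apply, smul_eq_mul,
      fderiv_besselSeries_norm_sq hν2 x i]
    simp
    ring
  unfold lap
  rw [Finset.sum_congr rfl fun i _ => key i, Finset.sum_add_distrib, ← Finset.mul_sum]
  have hx : ∑ i, (x i) ^ 2 = ‖x‖ ^ 2 := by
    rw [EuclideanSpace.norm_sq_eq]; simp
  rw [hx, Finset.sum_const, Finset.card_univ, Fintype.card_fin, nsmul_eq_mul, radialEigenfunction,
    ← besselSeries_ode hν (‖x‖ ^ 2)]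
  ring

/-! ### Size of the eigenfunction on balls -/

lemma exists_one_add_rpow_le_exp {a b : ℝ} (ha : 0 ≤ a) (hb : 0 < b) :
    ∃ M, 0 < M ∧ ∀ δ, 0 ≤ δ → (1 + δ) ^ a ≤ M * Real.exp (b * δ) := by
  set c := b / (a + 1)
  have hc : 0 < c := by positivity
  have hm : 0 < min 1 c := lt_min one_pos hc
  refine ⟨(min 1 c)⁻¹ ^ a, by positivity, fun δ hδ => ?_⟩
  have h1 : 1 + δ ≤ (min 1 c)⁻¹ * Real.exp (c * δ) := by
    rw [← div_eq_inv_mul, le_div_iff₀ hm]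
    have := Real.add_one_le_exp (c * δ)
    have h2 := min_le_left 1 c
    have h3 := min_le_right 1 c
    nlinarith
  calc (1 + δ) ^ a ≤ ((min 1 c)⁻¹ * Real.exp (c * δ)) ^ a :=
        Real.rpow_le_rpow (by linarith) h1 ha
    _ = (min 1 c)⁻¹ ^ a * Real.exp (c * δ * a) := by
        rw [Real.mul_rpow (by positivity) (Real.exp_pos _).le, Real.exp_mul (c * δ)]
    _ ≤ _ := by
        refine mul_le_mul_of_nonneg_left (Real.exp_le_exp.2 ?_) (by positivity)
        have : c * a ≤ b := by
          simp only [c]; rw [div_mul_eq_mul_div, div_le_iff₀ (by positivity)]; nlinarith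
        nlinarith

/-- The ratio of the two powers is at most `(1 + (ρ - r)) ^ |α|`, polynomial in the gap whatever the
sign of `α`. Half of the exponential rate absorbs it; the other half remains as integrable decay
away from `ρ`. -/
lemma exists_rpow_mul_exp_le (α : ℝ) {s : ℝ} (hs : 0 < s) :
    ∃ M, 0 < M ∧ ∀ r ρ, 0 ≤ r → r ≤ ρ → (1 + r) ^ α * Real.exp (s * r) ≤
      M * ((1 + ρ) ^ α * Real.exp (s * ρ)) * Real.exp (-(s / 2) * (ρ - r)) := by
  obtain ⟨M, hM, h⟩ := exists_one_add_rpow_le_exp (abs_nonneg α) (half_pos hs)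
  refine ⟨M, hM, fun r ρ hr hrρ => ?_⟩
  have hr1 : 0 < 1 + r := by linarith
  have hρ1 : 0 < 1 + ρ := by linarith
  have h1 : (1 + r) ^ α ≤ (1 + ρ) ^ α * (1 + (ρ - r)) ^ |α| := by
    have hx : 1 ≤ (1 + ρ) / (1 + r) := by rw [one_le_div hr1]; linarith
    have hx' : (1 + ρ) / (1 + r) ≤ 1 + (ρ - r) := by
      rw [div_le_iff₀ hr1]; nlinarith
    calc (1 + r) ^ α = (1 + ρ) ^ α * ((1 + ρ) / (1 + r)) ^ (-α) := by
          rw [Real.div_rpow hρ1.le hr1.le, Real.rpow_neg hρ1.le, Real.rpow_neg hr1.le]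
          have := (Real.rpow_pos_of_pos hρ1 α).ne'
          have := (Real.rpow_pos_of_pos hr1 α).ne'
          field_simp
      _ ≤ (1 + ρ) ^ α * ((1 + ρ) / (1 + r)) ^ |α| := by
          gcongr
          · exact neg_le_abs α
      _ ≤ _ := by gcongr
  calc (1 + r) ^ α * Real.exp (s * r)
      ≤ (1 + ρ) ^ α * (M * Real.exp (s / 2 * (ρ - r))) * Real.exp (s * r) := by
        gcongr
        exact h1.trans (by gcongr; exact h _ (by linarith))
    _ = M * (1 + ρ) ^ α * (Real.exp (s / 2 * (ρ - r)) * Real.exp (s * r)) := by ring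
    _ = M * (1 + ρ) ^ α * (Real.exp (s * ρ) * Real.exp (-(s / 2) * (ρ - r))) := by
        rw [← Real.exp_add, ← Real.exp_add]; congr 2; ring
    _ = _ := by ring

/-- In polar coordinates the integrand is at most a multiple of `(1 + r) ^ ((n - 1) (1 - s / 2)) e ^
(s r)`. It concentrates within bounded distance of the sphere of radius `ρ`, so integrating costs a
constant and no power of `ρ`. -/
lemma exists_integral_radialEigenfunction_le (hn : 1 ≤ n) {s : ℝ} (hs : 0 < s) :
    ∃ C, 0 < C ∧ ∀ ρ, 0 ≤ ρ → ∫ x in Metric.closedBall (0 : E n) ρ, radialEigenfunction x ^ s ≤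
      C * ((1 + ρ) ^ (((n : ℝ) - 1) * (1 - s / 2)) * Real.exp (s * ρ)) := by
  have hν : (1 : ℝ) ≤ n := by exact_mod_cast hn
  obtain ⟨C₀, hC₀, hΦ⟩ := exists_besselSeries_sq_le hν
  obtain ⟨M, hM, hMle⟩ := exists_rpow_mul_exp_le (((n : ℝ) - 1) * (1 - s / 2)) hs
  have : Nonempty (Fin n) := ⟨⟨0, hn⟩⟩
  set V : ℝ := (volume : Measure (E n)).real (Metric.ball 0 1)
  have hV : 0 ≤ V := measureReal_nonneg
  refine ⟨n * ((V + 1) * (C₀ ^ s * M * (2 / s))), by positivity, fun ρ hρ => ?_⟩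
  set f : ℝ → ℝ := (Iic ρ).indicator fun r => besselSeries n (r ^ 2) ^ s
  have e1 : ∫ x in Metric.closedBall (0 : E n) ρ, radialEigenfunction x ^ s = ∫ x : E n, f ‖x‖ := by
    rw [← integral_indicator Metric.isClosed_closedBall.measurableSet]
    congr 1
    funext x
    by_cases hx : ‖x‖ ≤ ρ
    · rw [indicator_of_mem (by simpa using hx)]
      simp only [f]
      rw [indicator_of_mem (by simpa using hx)]; rfl
    · rw [indicator_of_notMem (by simpa using hx)]
      simp only [f]
      rw [indicator_of_notMem (by simpa using hx)]
  rw [e1, integral_fun_norm_addHaar volume f]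
  rw [finrank_euclideanSpace_fin, nsmul_eq_mul, smul_eq_mul]
  have hP : 0 < (1 + ρ) ^ (((n : ℝ) - 1) * (1 - s / 2)) * Real.exp (s * ρ) := by positivity
  set P := (1 + ρ) ^ (((n : ℝ) - 1) * (1 - s / 2)) * Real.exp (s * ρ)
  have hmain : ∫ y in Ioi (0 : ℝ), y ^ (n - 1) • f y ≤ C₀ ^ s * M * (2 / s) * P := by
    have e2 : ∫ y in Ioi (0 : ℝ), y ^ (n - 1) • f y =
        ∫ y in (0 : ℝ)..ρ, y ^ (n - 1) * besselSeries n (y ^ 2) ^ s := by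
      rw [intervalIntegral.integral_of_le hρ, ← Ioi_inter_Iic,
        ← setIntegral_indicator measurableSet_Iic]
      congr 1
      funext y
      by_cases hy : y ∈ Iic ρ <;> simp [f, hy]
    rw [e2]
    have hcont : Continuous fun y : ℝ => y ^ (n - 1) * besselSeries n (y ^ 2) ^ s := by
      have := (contDiff_besselSeries hν).continuous
      exact (by fun_prop : Continuous fun y : ℝ => y ^ (n - 1)).mul
        ((this.comp (by fun_prop : Continuous fun y : ℝ => y ^ 2)).rpow_const
          fun y => Or.inr hs.le)
    have hcont2 : Continuous fun y : ℝ => C₀ ^ s * M * P * Real.exp (-(s / 2) * (ρ - y)) := by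
      fun_prop
    have hle : ∀ y ∈ Icc 0 ρ, y ^ (n - 1) * besselSeries n (y ^ 2) ^ s ≤
        C₀ ^ s * M * P * Real.exp (-(s / 2) * (ρ - y)) := by
      intro y hy
      have hy1 : 0 < 1 + y := by linarith [hy.1]
      have hB := zero_le_one.trans (one_le_besselSeries hν (sq_nonneg y))
      have h1 : y ^ (n - 1) ≤ (1 + y) ^ ((n : ℝ) - 1) := by
        rw [show (n : ℝ) - 1 = ((n - 1 : ℕ) : ℝ) by rw [Nat.cast_sub hn, Nat.cast_one],
          Real.rpow_natCast]
        exact pow_le_pow_left₀ hy.1 (by linarith) _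
      calc y ^ (n - 1) * besselSeries n (y ^ 2) ^ s
          ≤ (1 + y) ^ ((n : ℝ) - 1) *
            (C₀ * (Real.exp y * (1 + y) ^ (-(((n : ℝ) - 1) / 2)))) ^ s := by
            gcongr
            exact hΦ y hy.1
        _ = C₀ ^ s * ((1 + y) ^ (((n : ℝ) - 1) * (1 - s / 2)) * Real.exp (s * y)) := by
            rw [Real.mul_rpow hC₀.le (by positivity), Real.mul_rpow (Real.exp_pos y).le
              (by positivity), ← Real.rpow_mul hy1.le, ← Real.exp_mul, mul_comm y s]
            rw [show ((n : ℝ) - 1) * (1 - s / 2) = ((n : ℝ) - 1) + -(((n : ℝ) - 1) / 2) * s by ring,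
              Real.rpow_add hy1]
            ring
        _ ≤ C₀ ^ s * (M * P * Real.exp (-(s / 2) * (ρ - y))) := by
            exact mul_le_mul_of_nonneg_left (hMle y ρ hy.1 hy.2) (by positivity)
        _ = _ := by ring
    refine (intervalIntegral.integral_mono_on hρ (hcont.intervalIntegrable _ _)
      (hcont2.intervalIntegrable _ _) hle).trans ?_
    have hint : ∫ y in (0 : ℝ)..ρ, Real.exp (-(s / 2) * (ρ - y)) ≤ 2 / s := by
      have hd : ∀ y : ℝ, HasDerivAt (fun y => 2 / s * Real.exp (-(s / 2) * (ρ - y)))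
          (Real.exp (-(s / 2) * (ρ - y))) y := by
        intro y
        have := ((((hasDerivAt_id y).const_sub ρ).const_mul (-(s / 2))).exp).const_mul (2 / s)
        refine this.congr_deriv ?_
        simp only [id]
        field_simp
      rw [intervalIntegral.integral_eq_sub_of_hasDerivAt (fun y _ => hd y)
        ((by fun_prop : Continuous fun y : ℝ => Real.exp (-(s / 2) * (ρ - y))).intervalIntegrable _ _)]
      simp
      positivity
    rw [intervalIntegral.integral_const_mul]
    calc C₀ ^ s * M * P * _ ≤ C₀ ^ s * M * P * (2 / s) := by gcongr
      _ = _ := by ring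
  calc (n : ℝ) * V • ∫ y in Ioi (0 : ℝ), y ^ (n - 1) • f y
      ≤ n * ((V + 1) * (C₀ ^ s * M * (2 / s) * P)) := by
        rw [smul_eq_mul]
        refine mul_le_mul_of_nonneg_left ?_ (by positivity)
        refine mul_le_mul (by linarith) hmain ?_ (by positivity)
        refine setIntegral_nonneg measurableSet_Ioi fun y hy => ?_
        refine smul_nonneg (pow_nonneg (le_of_lt hy) _) (indicator_nonneg (fun r _ => ?_) _)
        exact Real.rpow_nonneg (zero_le_one.trans (one_le_besselSeries hν (sq_nonneg r))) _
    _ = _ := by ring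

/-! ### Pairing a solution with spatial test functions -/

lemma integrable_mul_of_hasCompactSupport {f φ : E n → ℝ} (hf : LocallyIntegrable f)
    (hφ : Continuous φ) (hc : HasCompactSupport φ) : Integrable fun x => f x * φ x :=
  hf.integrable_smul_right_of_hasCompactSupport hφ hc

lemma abs_integral_mul_le {f φ : E n → ℝ} {K : Set (E n)} {M : ℝ} (hK : IsCompact K)
    (hf : LocallyIntegrable f) (hM : ∀ x, ‖φ x‖ ≤ M) (h0 : ∀ x, x ∉ K → φ x = 0) :
    |∫ x, f x * φ x| ≤ M * ∫ x in K, ‖f x‖ := by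
  have e : ∫ x, f x * φ x = ∫ x in K, f x * φ x := by
    rw [setIntegral_eq_integral_of_forall_compl_eq_zero]
    intro x hx
    rw [h0 x hx, mul_zero]
  rw [e, ← Real.norm_eq_abs, ← integral_const_mul]
  refine norm_integral_le_of_norm_le ((hf.integrableOn_isCompact hK).norm.const_mul M)
    (ae_of_all _ fun x => ?_)
  rw [norm_mul, mul_comm]
  exact mul_le_mul_of_nonneg_right (hM x) (norm_nonneg _)

lemma ContL1loc.continuousOn_integral_mul {T : EReal} {f : ℝ → E n → ℝ} (hf : ContL1loc T f)
    {φ : E n → ℝ} (hφ : Continuous φ) (hc : HasCompactSupport φ) :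
    ContinuousOn (fun s => ∫ x, f s x * φ x) (timeDomain T) := by
  intro t ht
  obtain ⟨M, hM⟩ := hφ.bounded_above_of_compact_support hc
  have h := (hf.2 t ht (tsupport φ) hc).const_mul M
  rw [mul_zero] at h
  refine tendsto_iff_norm_sub_tendsto_zero.2
    (squeeze_zero' (Eventually.of_forall fun _ => norm_nonneg _) ?_ h)
  filter_upwards [self_mem_nhdsWithin] with s hs
  rw [← integral_sub (integrable_mul_of_hasCompactSupport (hf.1 s hs) hφ hc)
    (integrable_mul_of_hasCompactSupport (hf.1 t ht) hφ hc)]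
  simp only [← sub_mul]
  exact abs_integral_mul_le hc ((hf.1 s hs).sub (hf.1 t ht)) hM fun x hx =>
    image_eq_zero_of_notMem_tsupport hx

lemma C1L1loc.hasDerivWithinAt_integral_mul {T : EReal} {w wt : ℝ → E n → ℝ} (hw : C1L1loc T w wt)
    {φ : E n → ℝ} (hφ : Continuous φ) (hc : HasCompactSupport φ) {t : ℝ} (ht : t ∈ timeDomain T) :
    HasDerivWithinAt (fun s => ∫ x, w s x * φ x) (∫ x, wt t x * φ x) (timeDomain T) t := by
  obtain ⟨⟨hw0, -⟩, ⟨hwt0, -⟩, hd⟩ := hw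
  obtain ⟨M, hM⟩ := hφ.bounded_above_of_compact_support hc
  have h := (hd t ht (tsupport φ) hc).const_mul M
  rw [mul_zero] at h
  rw [hasDerivWithinAt_iff_tendsto_slope]
  refine tendsto_iff_norm_sub_tendsto_zero.2
    (squeeze_zero' (Eventually.of_forall fun _ => norm_nonneg _) ?_ h)
  filter_upwards [self_mem_nhdsWithin] with s hs
  have e : slope (fun s => ∫ x, w s x * φ x) t s - ∫ x, wt t x * φ x =
      ∫ x, ((w s x - w t x) / (s - t) - wt t x) * φ x := by
    rw [slope_def_field,
      ← integral_sub (integrable_mul_of_hasCompactSupport (hw0 s hs.1) hφ hc)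
      (integrable_mul_of_hasCompactSupport (hw0 t ht) hφ hc), ← integral_div, ← integral_sub]
    · congr 1
      funext x
      ring
    · exact ((integrable_mul_of_hasCompactSupport (hw0 s hs.1) hφ hc).sub
        (integrable_mul_of_hasCompactSupport (hw0 t ht) hφ hc)).div_const _
    · exact integrable_mul_of_hasCompactSupport (hwt0 t ht) hφ hc
  rw [e]
  have hli : LocallyIntegrable fun x => (w s x - w t x) / (s - t) - wt t x := by
    have := (((hw0 s hs.1).sub (hw0 t ht)).smul (s - t)⁻¹).sub (hwt0 t ht)
    refine this.congr (ae_of_all _ fun x => ?_)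
    simp [div_eq_inv_mul]
  exact abs_integral_mul_le hc hli hM fun x hx => image_eq_zero_of_notMem_tsupport hx

lemma gradient_apply {φ : E n → ℝ} (x : E n) (i : Fin n) :
    ∇ φ x i = fderiv ℝ φ x (EuclideanSpace.single i 1) := by
  have : inner ℝ (∇ φ x) (EuclideanSpace.single i (1 : ℝ)) =
      fderiv ℝ φ x (EuclideanSpace.single i 1) :=
    InnerProductSpace.toDual_symm_apply
  rw [← this, real_inner_comm, EuclideanSpace.inner_single_left]
  simp

lemma gradient_const_mul {φ : E n → ℝ} (c : ℝ) {x : E n} (h : DifferentiableAt ℝ φ x) :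
    ∇ (fun y => c * φ y) x = c • ∇ φ x := by
  ext i
  rw [gradient_apply, fderiv_const_mul h]
  simp [gradient_apply]

lemma contDiff_fderiv_single {φ : E n → ℝ} (hφ : ContDiff ℝ ∞ φ) (i : Fin n) :
    ContDiff ℝ ∞ fun y => fderiv ℝ φ y (EuclideanSpace.single i 1) :=
  (hφ.fderiv_right (m := ∞) (by simp)).clm_apply contDiff_const

lemma hasCompactSupport_fderiv_single {φ : E n → ℝ} (hc : HasCompactSupport φ) (i : Fin n) :
    HasCompactSupport fun y => fderiv ℝ φ y (EuclideanSpace.single i 1) :=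
  hc.fderiv_apply ℝ _

/-- The `i`-th component of the defining identity, applied to the `i`-th partial derivative of `φ`,
summed over `i`. -/
lemma HasWeakGradient.integral_inner_gradient {w : E n → ℝ} {g : E n → E n}
    (h : HasWeakGradient w g) {φ : E n → ℝ} (hφ : ContDiff ℝ ∞ φ) (hc : HasCompactSupport φ) :
    ∫ x, inner ℝ (g x) (∇ φ x) = - ∫ x, w x * lap φ x := by
  obtain ⟨hw, hg, hwg⟩ := h
  have hgi : ∀ i, LocallyIntegrable fun x => g x i := fun i x => by
    obtain ⟨u, hu, hgu⟩ := hg x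
    exact ⟨u, hu, (EuclideanSpace.proj i : E n →L[ℝ] ℝ).integrable_comp hgu⟩
  have c1 : ∀ i, ContDiff ℝ ∞ fun y => fderiv ℝ φ y (EuclideanSpace.single i 1) :=
    fun i => contDiff_fderiv_single hφ i
  have k1 : ∀ i, HasCompactSupport fun y => fderiv ℝ φ y (EuclideanSpace.single i 1) :=
    fun i => hasCompactSupport_fderiv_single hc i
  have key : ∀ i, ∫ x, g x i * fderiv ℝ φ x (EuclideanSpace.single i 1) =
      - ∫ x, w x * fderiv ℝ (fun y => fderiv ℝ φ y (EuclideanSpace.single i 1)) x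
        (EuclideanSpace.single i 1) := by
    intro i
    have h1 := congrArg (fun z => (EuclideanSpace.proj i : E n →L[ℝ] ℝ) z) (hwg _ (c1 i) (k1 i))
    have cg : Continuous (∇ fun y => fderiv ℝ φ y (EuclideanSpace.single i 1)) := by
      have : Continuous (fderiv ℝ fun y => fderiv ℝ φ y (EuclideanSpace.single i 1)) :=
        (c1 i).continuous_fderiv (by simp)
      exact (InnerProductSpace.toDual ℝ (E n)).symm.continuous.comp this
    have kg : HasCompactSupport (∇ fun y => fderiv ℝ φ y (EuclideanSpace.single i 1)) := by
      refine ((k1 i).fderiv ℝ).comp_left (g := (InnerProductSpace.toDual ℝ (E n)).symm) (by simp)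
    simp only [map_neg] at h1
    rw [← ContinuousLinearMap.integral_comp_comm _
      (hw.integrable_smul_right_of_hasCompactSupport cg kg),
      ← ContinuousLinearMap.integral_comp_comm _
      (hg.integrable_smul_left_of_hasCompactSupport (c1 i).continuous (k1 i))] at h1
    simp only [map_smul, PiLp.proj_apply, gradient_apply, smul_eq_mul] at h1
    rw [h1, neg_neg]
    congr 1
    funext x
    ring
  have e1 : ∀ x, inner ℝ (g x) (∇ φ x) =
      ∑ i, g x i * fderiv ℝ φ x (EuclideanSpace.single i 1) := by
    intro x
    rw [PiLp.inner_apply]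
    refine Finset.sum_congr rfl fun i _ => ?_
    rw [gradient_apply]
    simp [mul_comm]
  simp only [e1, lap, Finset.mul_sum]
  rw [integral_finsetSum _ fun i _ => integrable_mul_of_hasCompactSupport (hgi i)
    (c1 i).continuous (k1 i), integral_finsetSum _ fun i _ => integrable_mul_of_hasCompactSupport hw
    (contDiff_fderiv_single (c1 i) i).continuous (hasCompactSupport_fderiv_single (k1 i) i),
    ← Finset.sum_neg_distrib]
  exact Finset.sum_congr rfl fun i _ => key i

/-- The weights used later are singular at `s = -1` and do not vanish near `T`, so they are not
admissible. A bump equal to `1` near `[0, t]` repairs this without changing the values or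
derivatives that the weak form sees. -/
lemma exists_isTestFunction_mul {T : EReal} {t : ℝ} (ht : 0 < t) (htT : (t : EReal) < T)
    {ρ : ℝ → ℝ} (hρ : ContDiffOn ℝ ∞ ρ (Ioi (-1))) {φ : E n → ℝ} (hφ : ContDiff ℝ ∞ φ)
    (hc : HasCompactSupport φ) :
    ∃ κ : ℝ → ℝ, IsTestFunction T (fun z : ℝ × E n => κ z.1 * φ z.2) ∧
      ∀ s ∈ Icc 0 t, κ =ᶠ[𝓝 s] ρ := by
  obtain ⟨t', htt', ht'T⟩ := EReal.lt_iff_exists_real_btwn.1 htT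
  rw [EReal.coe_lt_coe_iff] at htt'
  -- The bump is supported in `[-2δ, t + 2δ]`: the bound `1 / 8` keeps this to the right of `-1`,
  -- the other one below `t' < T`.
  set δ := min ((t' - t) / 4) (1 / 8)
  have hδ : 0 < δ := lt_min (by linarith) (by norm_num)
  have hδ1 : δ ≤ (t' - t) / 4 := min_le_left _ _
  have hδ2 : δ ≤ 1 / 8 := min_le_right _ _
  let f : ContDiffBump (t / 2) := ⟨t / 2 + δ, t / 2 + 2 * δ, by linarith, by linarith⟩
  have hfsupp : tsupport (fun s => f s * ρ s) ⊆ Icc (-(2 * δ)) (t + 2 * δ) := by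
    refine (tsupport_mul_subset_left).trans ?_
    rw [f.tsupport_eq, Real.closedBall_eq_Icc]
    refine Icc_subset_Icc ?_ ?_ <;> simp only [f] <;> linarith
  have hfρ : ContDiff ℝ ∞ fun s => f s * ρ s := by
    refine contDiff_iff_contDiffAt.2 fun s => ?_
    by_cases hs : s ∈ tsupport fun s => f s * ρ s
    swap
    · exact contDiffAt_const.congr_of_eventuallyEq (notMem_tsupport_iff_eventuallyEq.1 hs)
    have : -1 < s := by linarith [(hfsupp hs).1]
    exact f.contDiffAt.mul (hρ.contDiffAt (Ioi_mem_nhds this))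
  refine ⟨fun s => f s * ρ s, ⟨?_, ?_, ?_⟩, fun s hs => ?_⟩
  · exact (hfρ.comp contDiff_fst).mul (hφ.comp contDiff_snd)
  · refine HasCompactSupport.intro (K := Icc (-(2 * δ)) (t + 2 * δ) ×ˢ tsupport φ)
      (isCompact_Icc.prod hc) fun z hz => ?_
    rw [mem_prod, not_and_or] at hz
    rcases hz with hz | hz
    · have : f z.1 * ρ z.1 = 0 :=
        image_eq_zero_of_notMem_tsupport (f := fun s => f s * ρ s) fun h => hz (hfsupp h)
      simp only [this, zero_mul]
    · rw [image_eq_zero_of_notMem_tsupport hz, mul_zero]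
  · intro z hz
    have hsub : tsupport (fun z : ℝ × E n => f z.1 * ρ z.1 * φ z.2) ⊆
        {z | z.1 ∈ Icc (-(2 * δ)) (t + 2 * δ)} := by
      refine closure_minimal (fun z hz => ?_) (isClosed_Icc.preimage continuous_fst)
      refine hfsupp (subset_tsupport _ ?_)
      exact left_ne_zero_of_mul hz
    have : z.1 < t' := by linarith [(hsub hz).2]
    exact (EReal.coe_lt_coe_iff.2 this).trans ht'T
  · have hs' : s ∈ Metric.ball (t / 2) f.rIn := by
      rw [Real.ball_eq_Ioo]
      simp only [f]
      exact ⟨by linarith [hs.1], by linarith [hs.2]⟩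
    filter_upwards [f.eventuallyEq_one_of_mem_ball hs'] with r hr
    rw [hr]; simp

/-- Testing with the product `ρ(s) φ(x)` separates the variables: the weak equation becomes a scalar
identity in time for the averages of the solution, with the gradient moved onto `φ` as a Laplacian.
-/
lemma SatisfiesDampedWave.integral_mul_eq {T : EReal} {b : ℝ → ℝ} {w₁ : E n → ℝ}
    {w wt : ℝ → E n → ℝ} {g : ℝ → E n → E n} {h : ℝ → E n → ℝ}
    (hS : SatisfiesDampedWave T b w₁ wt g h) (hW : ContW11loc T w g) (hw : C1L1loc T w wt)
    {φ : E n → ℝ} (hφ : ContDiff ℝ ∞ φ) (hc : HasCompactSupport φ)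
    {ρ : ℝ → ℝ} (hρ : ContDiffOn ℝ ∞ ρ (Ioi (-1))) {t : ℝ} (ht : 0 < t) (htT : (t : EReal) < T) :
    (∫ s in (0 : ℝ)..t, (-(deriv ρ s * ∫ x, wt s x * φ x) - ρ s * ∫ x, w s x * lap φ x)
        + b s * ρ s * ∫ x, wt s x * φ x) + ρ t * ∫ x, wt t x * φ x =
      ρ 0 * (∫ x, w₁ x * φ x) + ∫ s in (0 : ℝ)..t, ρ s * ∫ x, h s x * φ x := by
  obtain ⟨κ, hκ, hκρ⟩ := exists_isTestFunction_mul ht htT hρ hφ hc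
  have key := hS _ hκ t ht htT
  have hκ' : ∀ s ∈ Icc 0 t, κ s = ρ s := fun s hs => (hκρ s hs).eq_of_nhds
  have hφd : ∀ x, DifferentiableAt ℝ φ x := fun x => hφ.differentiable (by simp) x
  have e1 : ∀ s ∈ uIcc 0 t, ∫ x, (-(wt s x * deriv (fun σ => κ σ * φ x) s)
        + inner ℝ (g s x) (∇ (fun y => κ s * φ y) x) + b s * wt s x * (κ s * φ x)) =
      (-(deriv ρ s * ∫ x, wt s x * φ x) - ρ s * ∫ x, w s x * lap φ x)
        + b s * ρ s * ∫ x, wt s x * φ x := by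
    intro s hs
    rw [uIcc_of_le ht.le] at hs
    have hsT : s ∈ timeDomain T :=
      ⟨hs.1, lt_of_le_of_lt (EReal.coe_le_coe_iff.2 hs.2) htT⟩
    have hI := integrable_mul_of_hasCompactSupport (hw.2.1.1 s hsT) hφ.continuous hc
    have hg := (hW.1 s hsT).2.1
    have cg : Continuous (∇ φ) :=
      (InnerProductSpace.toDual ℝ (E n)).symm.continuous.comp (hφ.continuous_fderiv (by simp))
    have kg : HasCompactSupport (∇ φ) :=
      (hc.fderiv ℝ).comp_left (g := (InnerProductSpace.toDual ℝ (E n)).symm) (by simp)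
    have hJ : Integrable fun x => inner ℝ (g s x) (∇ φ x) := by
      rw [← integrableOn_iff_integrable_of_support_subset (s := tsupport (∇ φ))]
      · obtain ⟨M, hM⟩ := cg.bounded_above_of_compact_support kg
        have hgK := hg.integrableOn_isCompact kg
        refine (hgK.norm.const_mul M).mono'
          (hgK.aestronglyMeasurable.inner cg.aestronglyMeasurable) (ae_of_all _ fun x => ?_)
        calc ‖inner ℝ (g s x) (∇ φ x)‖ ≤ ‖g s x‖ * ‖∇ φ x‖ := norm_inner_le_norm _ _
          _ ≤ ‖g s x‖ * M := by gcongr; exact hM x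
          _ = _ := mul_comm _ _
      · intro x hx
        by_contra hx'
        exact hx (by simp [image_eq_zero_of_notMem_tsupport hx'])
    have e2 : ∀ x, (-(wt s x * deriv (fun σ => κ σ * φ x) s)
        + inner ℝ (g s x) (∇ (fun y => κ s * φ y) x) + b s * wt s x * (κ s * φ x)) =
        (-deriv ρ s) * (wt s x * φ x) + ρ s * inner ℝ (g s x) (∇ φ x)
          + b s * ρ s * (wt s x * φ x) := by
      intro x
      have : deriv (fun σ => κ σ * φ x) s = deriv ρ s * φ x := by
        rw [deriv_mul_const_field, (hκρ s hs).deriv_eq]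
      rw [this, gradient_const_mul _ (hφd x), inner_smul_right, hκ' s hs]
      ring
    have i1 := hI.const_mul (-deriv ρ s)
    have i2 := hJ.const_mul (ρ s)
    have i3 := hI.const_mul (b s * ρ s)
    simp only [e2]
    have i4 : Integrable fun x => -deriv ρ s * (wt s x * φ x) + ρ s * inner ℝ (g s x) (∇ φ x) :=
      i1.add i2
    rw [integral_add i4 i3, integral_add i1 i2, integral_const_mul, integral_const_mul,
      integral_const_mul, (hW.1 s hsT).integral_inner_gradient hφ hc]
    ring
  rw [intervalIntegral.integral_congr e1] at key
  have e3 : ∀ (f : E n → ℝ) (c : ℝ), ∫ x, f x * (c * φ x) = c * ∫ x, f x * φ x := by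
    intro f c
    rw [← integral_const_mul]
    congr 1
    funext x
    ring
  simp only [e3] at key
  rw [hκ' t (right_mem_Icc.2 ht.le), hκ' 0 (left_mem_Icc.2 ht.le)] at key
  rw [key]
  congr 1
  refine intervalIntegral.integral_congr fun s hs => ?_
  rw [uIcc_of_le ht.le] at hs
  simp only [hκ' s hs]

/-! ### Hölder's inequality and integrability of the nonlinearities -/

lemma integral_mul_rpow_le {α : Type*} [MeasurableSpace α] {m : Measure α} {f g : α → ℝ} {p : ℝ}
    (hp : 1 < p) (hf : MemLp f (ENNReal.ofReal p) m)
    (hg : MemLp g (ENNReal.ofReal p.conjExponent) m) :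
    (∫ a, |f a| * |g a| ∂m) ^ p ≤
      (∫ a, |f a| ^ p ∂m) * (∫ a, |g a| ^ p.conjExponent ∂m) ^ (p - 1) := by
  have h := integral_mul_norm_le_Lp_mul_Lq (Real.HolderConjugate.conjExponent hp) hf hg
  simp only [Real.norm_eq_abs] at h
  have hA : 0 ≤ ∫ a, |f a| ^ p ∂m := integral_nonneg fun a => by positivity
  have hB : 0 ≤ ∫ a, |g a| ^ p.conjExponent ∂m := integral_nonneg fun a => by positivity
  refine (Real.rpow_le_rpow (integral_nonneg fun a => by positivity) h (by linarith)).trans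
    (le_of_eq ?_)
  rw [Real.mul_rpow (by positivity) (by positivity), ← Real.rpow_mul hA, ← Real.rpow_mul hB,
    one_div_mul_cancel (by linarith), Real.rpow_one]
  congr 2
  rw [Real.conjExponent]
  have : p - 1 ≠ 0 := by linarith
  have : p ≠ 0 := by linarith
  field_simp

/-- Hölder's inequality for a function supported in a ball. -/
lemma abs_integral_mul_rpow_le {p r : ℝ} (hp : 1 < p) {f g χ : E n → ℝ}
    (hf : AEStronglyMeasurable f) (hfr : SupportedInBall r f) (hg : Continuous g)
    (hχ : Continuous χ) (hc : HasCompactSupport χ) (hχ0 : ∀ x, 0 ≤ χ x)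
    (hχ1 : ∀ x ∈ Metric.closedBall (0 : E n) r, χ x = 1)
    (hfp : IntegrableOn (fun x => |f x| ^ p) (tsupport χ)) :
    |∫ x, f x * g x| ^ p ≤ (∫ x, |f x| ^ p * χ x) *
      (∫ x in Metric.closedBall (0 : E n) r, |g x| ^ p.conjExponent) ^ (p - 1) := by
  set B := Metric.closedBall (0 : E n) r
  have hBc : IsCompact B := isCompact_closedBall 0 r
  have hBχ : B ⊆ tsupport χ := fun x hx => subset_tsupport _ (by simp [hχ1 x hx])
  have hp0 : ENNReal.ofReal p ≠ 0 := by simp; linarith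
  have hq := (Real.HolderConjugate.conjExponent hp).symm.pos
  have mf : MemLp f (ENNReal.ofReal p) (volume.restrict B) := by
    rw [← integrable_norm_rpow_iff hf.restrict hp0 ENNReal.ofReal_ne_top,
      ENNReal.toReal_ofReal (by linarith)]
    exact hfp.mono_set hBχ
  have mg : MemLp g (ENNReal.ofReal p.conjExponent) (volume.restrict B) := by
    rw [← integrable_norm_rpow_iff hg.aestronglyMeasurable (by simpa using hq)
      ENNReal.ofReal_ne_top, ENNReal.toReal_ofReal hq.le]
    exact (hg.norm.rpow_const fun x => Or.inr hq.le).continuousOn.integrableOn_compact hBc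
  have e1 : ∫ x, f x * g x = ∫ x in B, f x * g x := by
    refine (setIntegral_eq_integral_of_ae_compl_eq_zero ?_).symm
    filter_upwards [hfr] with x hx hxB
    rw [hx (by simpa [B] using hxB), zero_mul]
  have h1 : |∫ x, f x * g x| ≤ ∫ x in B, |f x| * |g x| := by
    rw [e1]
    simpa only [abs_mul] using abs_integral_le_integral_abs (μ := volume.restrict B)
      (f := fun x => f x * g x)
  have h2 : ∫ x in B, |f x| ^ p ≤ ∫ x, |f x| ^ p * χ x := by
    have hint : Integrable fun x => |f x| ^ p * χ x := by
      rw [← integrableOn_iff_integrable_of_support_subset (s := tsupport χ)]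
      · obtain ⟨M, hM⟩ := hχ.bounded_above_of_compact_support hc
        exact hfp.mul_bdd hχ.aestronglyMeasurable (ae_of_all _ hM)
      · intro x hx
        exact subset_tsupport _ (right_ne_zero_of_mul hx)
    calc ∫ x in B, |f x| ^ p = ∫ x in B, |f x| ^ p * χ x :=
          setIntegral_congr_fun hBc.measurableSet fun x hx => by simp [hχ1 x hx]
      _ ≤ _ := setIntegral_le_integral hint (ae_of_all _ fun x => mul_nonneg
          (Real.rpow_nonneg (abs_nonneg _) _) (hχ0 x))
  calc |∫ x, f x * g x| ^ p ≤ (∫ x in B, |f x| * |g x|) ^ p :=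
        Real.rpow_le_rpow (abs_nonneg _) h1 (by linarith)
    _ ≤ _ := integral_mul_rpow_le hp mf mg
    _ ≤ _ := by
        gcongr

lemma MemLrloc.integrable_prod {T : EReal} {r : ℝ} (hr : 0 < r) {w : ℝ → E n → ℝ}
    (hw : MemLrloc T r w) {τ : ℝ} (hτ : (τ : EReal) < T) {K : Set (E n)} (hK : IsCompact K) :
    Integrable (fun z : ℝ × E n => |w z.1 z.2| ^ r)
      ((volume.restrict (Icc 0 τ)).prod (volume.restrict K)) := by
  have h := hw (Icc 0 τ ×ˢ K) (isCompact_Icc.prod hK) (prod_mono (fun s hs =>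
    ⟨hs.1, lt_of_le_of_lt (EReal.coe_le_coe_iff.2 hs.2) hτ⟩) (subset_univ _))
  rw [Measure.prod_restrict, ← Measure.volume_eq_prod]
  have h2 := h.integrable_norm_rpow (by simpa using hr) ENNReal.ofReal_ne_top
  rwa [ENNReal.toReal_ofReal hr.le] at h2

/-- By Fubini, slices are integrable at almost every time only; this is why the pointwise estimates
of the forcing below hold almost everywhere in `s`. -/
lemma MemLrloc.ae_integrableOn {T : EReal} {r : ℝ} (hr : 0 < r) {w : ℝ → E n → ℝ}
    (hw : MemLrloc T r w) {τ : ℝ} (hτ : (τ : EReal) < T) {K : Set (E n)} (hK : IsCompact K) :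
    ∀ᵐ s ∂(volume.restrict (Icc 0 τ)), IntegrableOn (fun x => |w s x| ^ r) K :=
  (hw.integrable_prod hr hτ hK).prod_right_ae

lemma MemLrloc.intervalIntegrable {T : EReal} {r : ℝ} (hr : 0 < r) {w : ℝ → E n → ℝ}
    (hw : MemLrloc T r w) {τ : ℝ} (hτ0 : 0 ≤ τ) (hτ : (τ : EReal) < T) {φ : E n → ℝ}
    (hφ : Continuous φ) (hc : HasCompactSupport φ) :
    IntervalIntegrable (fun s => ∫ x, |w s x| ^ r * φ x) volume 0 τ := by
  rw [intervalIntegrable_iff_integrableOn_Icc_of_le hτ0]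
  obtain ⟨M, hM⟩ := hφ.bounded_above_of_compact_support hc
  have h := ((hw.integrable_prod hr hτ hc).mul_bdd
    (hφ.comp continuous_snd).aestronglyMeasurable
    (ae_of_all _ fun z => hM z.2)).integral_prod_left
  refine h.congr (ae_of_all _ fun s => ?_)
  refine setIntegral_eq_integral_of_forall_compl_eq_zero fun x hx => ?_
  simp only [Function.comp]
  rw [image_eq_zero_of_notMem_tsupport hx, mul_zero]

/-! ### Cut off power weights in time -/

/-- A smooth cutoff which is `1` for `s ≤ 1 / 2` and `0` for `1 ≤ s`. -/
noncomputable def timeCutoff (s : ℝ) : ℝ := Real.smoothTransition (2 - 2 * s)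

lemma contDiff_timeCutoff : ContDiff ℝ ∞ timeCutoff :=
  Real.smoothTransition.contDiff.comp (contDiff_const.sub (contDiff_const.mul contDiff_id))

lemma timeCutoff_nonneg (s : ℝ) : 0 ≤ timeCutoff s := Real.smoothTransition.nonneg _

lemma timeCutoff_le_one (s : ℝ) : timeCutoff s ≤ 1 := Real.smoothTransition.le_one _

lemma timeCutoff_of_le {s : ℝ} (h : s ≤ 1 / 2) : timeCutoff s = 1 :=
  Real.smoothTransition.one_of_one_le (by linarith)

lemma timeCutoff_one : timeCutoff 1 = 0 :=
  Real.smoothTransition.zero_of_nonpos (by norm_num)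

lemma deriv_timeCutoff_of_lt {s : ℝ} (h : s < 1 / 2) : deriv timeCutoff s = 0 := by
  have : timeCutoff =ᶠ[𝓝 s] fun _ => 1 := by
    filter_upwards [eventually_lt_nhds h] with r hr using timeCutoff_of_le hr.le
  rw [this.deriv_eq, deriv_const]

lemma deriv_deriv_timeCutoff_of_lt {s : ℝ} (h : s < 1 / 2) : deriv (deriv timeCutoff) s = 0 := by
  have : deriv timeCutoff =ᶠ[𝓝 s] fun _ => 0 := by
    filter_upwards [eventually_lt_nhds h] with r hr using deriv_timeCutoff_of_lt hr
  rw [this.deriv_eq, deriv_const]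

lemma hasDerivAt_timeCutoff (s : ℝ) : HasDerivAt timeCutoff (deriv timeCutoff s) s :=
  (contDiff_timeCutoff.differentiable (by simp) s).hasDerivAt

lemma contDiff_deriv_timeCutoff : ContDiff ℝ ∞ (deriv timeCutoff) :=
  (contDiff_infty_iff_deriv.1 contDiff_timeCutoff).2

lemma hasDerivAt_deriv_timeCutoff (s : ℝ) :
    HasDerivAt (deriv timeCutoff) (deriv (deriv timeCutoff) s) s :=
  (contDiff_deriv_timeCutoff.differentiable (by simp) s).hasDerivAt

lemma exists_abs_deriv_timeCutoff_le : ∃ M, 0 ≤ M ∧ ∀ s ∈ Icc (0 : ℝ) 1,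
    |deriv timeCutoff s| ≤ M ∧ |deriv (deriv timeCutoff) s| ≤ M := by
  obtain ⟨M₁, h₁⟩ := (isCompact_Icc (a := (0 : ℝ)) (b := 1)).exists_bound_of_continuousOn
    contDiff_deriv_timeCutoff.continuous.continuousOn
  obtain ⟨M₂, h₂⟩ := (isCompact_Icc (a := (0 : ℝ)) (b := 1)).exists_bound_of_continuousOn
    (contDiff_infty_iff_deriv.1 contDiff_deriv_timeCutoff).2.continuous.continuousOn
  exact ⟨max 0 (max M₁ M₂), le_max_left _ _, fun s hs =>
    ⟨(h₁ s hs).trans ((le_max_left _ _).trans (le_max_right _ _)),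
      (h₂ s hs).trans ((le_max_right _ _).trans (le_max_right _ _))⟩⟩

/-- The time weight `(1 + s) ^ m`, cut off at the time `τ`. -/
noncomputable def timeWeight (m : ℝ) (k : ℕ) (τ s : ℝ) : ℝ :=
  (1 + s) ^ m * timeCutoff (s / τ) ^ k

lemma contDiffOn_timeWeight (m : ℝ) (k : ℕ) (τ : ℝ) :
    ContDiffOn ℝ ∞ (timeWeight m k τ) (Ioi (-1)) := by
  refine ContDiffOn.mul ?_ ?_
  · intro s hs
    refine ContDiffAt.contDiffWithinAt ?_
    have : (1 + s) ≠ 0 := by have := mem_Ioi.1 hs; intro h; linarith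
    exact (contDiffAt_const.add contDiffAt_id).rpow_const_of_ne this
  · exact ((contDiff_timeCutoff.comp (contDiff_id.div_const τ)).pow k).contDiffOn

lemma hasDerivAt_timeCutoff_div (τ s : ℝ) :
    HasDerivAt (fun s => timeCutoff (s / τ)) (deriv timeCutoff (s / τ) / τ) s := by
  have := (hasDerivAt_timeCutoff (s / τ)).comp s ((hasDerivAt_id s).div_const τ)
  exact this.congr_deriv (by ring)

lemma hasDerivAt_deriv_timeCutoff_div (τ s : ℝ) :
    HasDerivAt (fun s => deriv timeCutoff (s / τ)) (deriv (deriv timeCutoff) (s / τ) / τ) s := by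
  have := (hasDerivAt_deriv_timeCutoff (s / τ)).comp s ((hasDerivAt_id s).div_const τ)
  exact this.congr_deriv (by ring)

lemma hasDerivAt_one_add_rpow (m : ℝ) {s : ℝ} (hs : 0 ≤ s) :
    HasDerivAt (fun s => (1 + s) ^ m) (m * (1 + s) ^ (m - 1)) s := by
  have := ((hasDerivAt_id s).const_add 1).rpow_const (p := m)
    (Or.inl (by simp only [id]; intro h; linarith))
  exact this.congr_deriv (by simp)

lemma hasDerivAt_timeWeight (m : ℝ) (k : ℕ) (τ : ℝ) {s : ℝ} (hs : 0 ≤ s) :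
    HasDerivAt (timeWeight m (k + 1) τ) (m * (1 + s) ^ (m - 1) * timeCutoff (s / τ) ^ (k + 1)
      + (1 + s) ^ m * ((k + 1) * timeCutoff (s / τ) ^ k * (deriv timeCutoff (s / τ) / τ))) s := by
  have := (hasDerivAt_one_add_rpow m hs).mul ((hasDerivAt_timeCutoff_div τ s).pow (k + 1))
  refine this.congr_deriv ?_
  push_cast
  simp

/-- The derivative of the test function `c ζ ^ (j + 2) - (1 + s) ^ m (ζ ^ (j + 2))'`. -/
noncomputable def testDeriv (m c : ℝ) (j : ℕ) (τ s : ℝ) : ℝ :=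
  c * ((j + 2) * timeCutoff (s / τ) ^ (j + 1) * (deriv timeCutoff (s / τ) / τ)) -
    (m * (1 + s) ^ (m - 1) * ((j + 2) * timeCutoff (s / τ) ^ (j + 1)
        * (deriv timeCutoff (s / τ) / τ))
      + (1 + s) ^ m * ((j + 2) * ((j + 1) * timeCutoff (s / τ) ^ j
          * (deriv timeCutoff (s / τ) / τ) * (deriv timeCutoff (s / τ) / τ)
        + timeCutoff (s / τ) ^ (j + 1) * (deriv (deriv timeCutoff) (s / τ) / τ / τ))))

lemma hasDerivAt_testDeriv (m c : ℝ) (j : ℕ) (τ : ℝ) {s : ℝ} (hs : 0 ≤ s) :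
    HasDerivAt (fun s => c * timeCutoff (s / τ) ^ (j + 2) -
      (1 + s) ^ m * ((j + 2) * timeCutoff (s / τ) ^ (j + 1) * (deriv timeCutoff (s / τ) / τ)))
      (testDeriv m c j τ s) s := by
  have h0 := hasDerivAt_timeCutoff_div τ s
  have h1 := (hasDerivAt_deriv_timeCutoff_div τ s).div_const τ
  have := ((h0.pow (j + 2)).const_mul c).sub ((hasDerivAt_one_add_rpow m hs).mul
    (((h0.pow (j + 1)).const_mul ((j : ℝ) + 2)).mul h1))
  refine this.congr_deriv ?_
  simp only [testDeriv, Nat.add_sub_cancel, show j + 2 - 1 = j + 1 by omega, Pi.pow_apply, Pi.mul_apply]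
  push_cast
  ring

lemma continuousOn_one_add_rpow (m τ : ℝ) : ContinuousOn (fun s : ℝ => (1 + s) ^ m) (Icc 0 τ) :=
  fun _ hs => (hasDerivAt_one_add_rpow m hs.1).continuousAt.continuousWithinAt

lemma continuous_timeCutoff_div (τ : ℝ) : Continuous fun s : ℝ => timeCutoff (s / τ) :=
  contDiff_timeCutoff.continuous.comp (continuous_id.div_const τ)

lemma continuousOn_timeWeight (m : ℝ) (k : ℕ) (τ : ℝ) :
    ContinuousOn (timeWeight m k τ) (Icc 0 τ) :=
  (continuousOn_one_add_rpow m τ).mul ((continuous_timeCutoff_div τ).pow k).continuousOn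

lemma continuousOn_testDeriv (m c : ℝ) (j : ℕ) (τ : ℝ) :
    ContinuousOn (testDeriv m c j τ) (Icc 0 τ) := by
  have h0 := (continuous_timeCutoff_div τ).continuousOn (s := Icc 0 τ)
  have h1 : ContinuousOn (fun s : ℝ => deriv timeCutoff (s / τ)) (Icc 0 τ) :=
    (contDiff_deriv_timeCutoff.continuous.comp (continuous_id.div_const τ)).continuousOn
  have h2 : ContinuousOn (fun s : ℝ => deriv (deriv timeCutoff) (s / τ)) (Icc 0 τ) :=
    ((contDiff_infty_iff_deriv.1 contDiff_deriv_timeCutoff).2.continuous.comp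
      (continuous_id.div_const τ)).continuousOn
  have h3 := continuousOn_one_add_rpow m τ
  have h4 := continuousOn_one_add_rpow (m - 1) τ
  unfold testDeriv
  fun_prop

lemma testDeriv_of_lt (m c : ℝ) (j : ℕ) {τ s : ℝ} (hτ : 0 < τ) (hs : s < τ / 2) :
    testDeriv m c j τ s = 0 := by
  have : s / τ < 1 / 2 := by rw [div_lt_iff₀ hτ]; linarith
  simp [testDeriv, deriv_timeCutoff_of_lt this, deriv_deriv_timeCutoff_of_lt this]

/-- On `[τ / 2, τ]` the quantities `1 + s` and `τ` are comparable. Two derivatives on the weight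
gain `τ ^ (m - 2)`, whereas the term with `c` carries a single derivative and gains only `τ ^ (-1)`;
hence the alternative in `h₂`. Differentiating twice uses up two powers of the cutoff and leaves the
`j`-th. -/
lemma exists_abs_testDeriv_le {m c γ : ℝ} (j : ℕ) (hm : 0 ≤ m) (hc : 0 ≤ c) (h₁ : m - 2 ≤ γ)
    (h₂ : c = 0 ∨ -1 ≤ γ) : ∃ C, 0 < C ∧ ∀ τ, 1 ≤ τ → ∀ s ∈ Icc (τ / 2) τ,
      |testDeriv m c j τ s| ≤ C * τ ^ γ * timeCutoff (s / τ) ^ j := by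
  obtain ⟨M, hM, hMle⟩ := exists_abs_deriv_timeCutoff_le
  refine ⟨c * ((j + 2) * M) + m * (2 ^ m * 2) * ((j + 2) * M)
    + 2 ^ m * ((j + 2) * ((j + 1) * M * M + M)) + 1, by positivity, fun τ hτ s hs => ?_⟩
  have hτ0 : 0 < τ := by linarith
  have hs0 : 0 ≤ s := by linarith [hs.1]
  have hs1 : 0 < 1 + s := by linarith
  have hx : s / τ ∈ Icc (0 : ℝ) 1 := ⟨by positivity, by rw [div_le_one hτ0]; exact hs.2⟩
  obtain ⟨hz1, hz2⟩ := hMle _ hx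
  set z := timeCutoff (s / τ)
  set z1 := deriv timeCutoff (s / τ)
  set z2 := deriv (deriv timeCutoff) (s / τ)
  have hz0 : 0 ≤ z := timeCutoff_nonneg _
  have hzle : z ≤ 1 := timeCutoff_le_one _
  have hzj : z ^ (j + 1) ≤ z ^ j := pow_le_pow_of_le_one hz0 hzle (by omega)
  have hW : (1 + s) ^ m ≤ 2 ^ m * τ ^ m := by
    rw [← Real.mul_rpow (by norm_num) hτ0.le]
    exact Real.rpow_le_rpow hs1.le (by linarith [hs.2]) hm
  have hW' : (1 + s) ^ (m - 1) ≤ 2 ^ m * 2 * (τ ^ m / τ) := by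
    rw [Real.rpow_sub_one hs1.ne']
    calc (1 + s) ^ m / (1 + s) ≤ (2 ^ m * τ ^ m) / (τ / 2) := by
          gcongr
          linarith [hs.1]
      _ = _ := by field_simp
  have hγ1 : τ ^ m / τ / τ ≤ τ ^ γ := by
    have : τ ^ m / τ / τ = τ ^ (m - 2) := by
      rw [show m - 2 = m - 1 - 1 by ring, Real.rpow_sub_one hτ0.ne', Real.rpow_sub_one hτ0.ne']
    rw [this]
    exact Real.rpow_le_rpow_of_exponent_le hτ h₁
  have hγ2 : c / τ ≤ c * τ ^ γ := by
    rcases h₂ with h | h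
    · simp [h]
    · rw [div_eq_mul_inv, ← Real.rpow_neg_one]
      gcongr
  have t1 : |c * ((j + 2) * z ^ (j + 1) * (z1 / τ))| ≤ c * ((j + 2) * M) * (τ ^ γ * z ^ j) := by
    rw [abs_mul, abs_mul, abs_mul, abs_div, abs_of_nonneg hc, abs_of_pos hτ0,
      abs_of_nonneg (by positivity : (0 : ℝ) ≤ (j : ℝ) + 2), abs_of_nonneg (pow_nonneg hz0 _)]
    calc c * ((j + 2) * z ^ (j + 1) * (|z1| / τ)) = (c / τ) * ((j + 2) * |z1| * z ^ (j + 1)) := by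
          ring
      _ ≤ (c * τ ^ γ) * ((j + 2) * M * z ^ j) := by gcongr
      _ = _ := by ring
  have t2 : |m * (1 + s) ^ (m - 1) * ((j + 2) * z ^ (j + 1) * (z1 / τ))| ≤
      m * (2 ^ m * 2) * ((j + 2) * M) * (τ ^ γ * z ^ j) := by
    rw [abs_mul, abs_mul, abs_mul, abs_mul, abs_div, abs_of_nonneg hm, abs_of_pos hτ0,
      abs_of_nonneg (by positivity : (0 : ℝ) ≤ (j : ℝ) + 2), abs_of_nonneg (pow_nonneg hz0 _),
      abs_of_nonneg (Real.rpow_nonneg hs1.le _)]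
    calc m * (1 + s) ^ (m - 1) * ((j + 2) * z ^ (j + 1) * (|z1| / τ))
        ≤ m * (2 ^ m * 2 * (τ ^ m / τ)) * ((j + 2) * z ^ j * (M / τ)) := by gcongr
      _ = m * (2 ^ m * 2) * ((j + 2) * M) * ((τ ^ m / τ / τ) * z ^ j) := by ring
      _ ≤ _ := by gcongr
  have t3 : |(1 + s) ^ m * ((j + 2) * ((j + 1) * z ^ j * (z1 / τ) * (z1 / τ)
      + z ^ (j + 1) * (z2 / τ / τ)))| ≤
      2 ^ m * ((j + 2) * ((j + 1) * M * M + M)) * (τ ^ γ * z ^ j) := by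
    have h5 : |(j + 1) * z ^ j * (z1 / τ) * (z1 / τ) + z ^ (j + 1) * (z2 / τ / τ)| ≤
        (j + 1) * z ^ j * (M / τ) * (M / τ) + z ^ j * (M / τ / τ) := by
      refine (abs_add_le _ _).trans ?_
      rw [abs_mul, abs_mul, abs_mul, abs_mul, abs_div, abs_div, abs_div, abs_of_pos hτ0,
        abs_of_nonneg (by positivity : (0 : ℝ) ≤ (j : ℝ) + 1), abs_of_nonneg (pow_nonneg hz0 _),
        abs_of_nonneg (pow_nonneg hz0 _)]
      gcongr
    rw [abs_mul, abs_mul, abs_of_nonneg (by positivity : (0 : ℝ) ≤ (j : ℝ) + 2),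
      abs_of_nonneg (Real.rpow_nonneg hs1.le _)]
    calc _ ≤ 2 ^ m * τ ^ m * ((j + 2) * ((j + 1) * z ^ j * (M / τ) * (M / τ)
          + z ^ j * (M / τ / τ))) := by gcongr
      _ = 2 ^ m * ((j + 2) * ((j + 1) * M * M + M)) * ((τ ^ m / τ / τ) * z ^ j) := by ring
      _ ≤ _ := by gcongr
  have hfin : 0 ≤ τ ^ γ * z ^ j := by positivity
  calc |testDeriv m c j τ s| ≤ _ :=
        (abs_sub _ _).trans (add_le_add le_rfl (abs_add_le _ _))
    _ ≤ c * ((j + 2) * M) * (τ ^ γ * z ^ j) + (m * (2 ^ m * 2) * ((j + 2) * M) * (τ ^ γ * z ^ j) +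
        2 ^ m * ((j + 2) * ((j + 1) * M * M + M)) * (τ ^ γ * z ^ j)) := by gcongr
    _ ≤ _ := by linarith

/-- The functional inequality obtained by testing the spatially averaged equation with
a cut off power weight. -/
lemma exists_weighted_functional_bound {m c γ : ℝ} (j : ℕ) (hm : 0 ≤ m) (hc : 0 ≤ c)
    (h₁ : m - 2 ≤ γ) (h₂ : c = 0 ∨ -1 ≤ γ) :
    ∃ C, 0 < C ∧ ∀ τ, 1 ≤ τ → ∀ (F F' b H : ℝ → ℝ) (F₁ : ℝ),
      (∀ s ∈ Icc 0 τ, b s * (1 + s) ^ m - m * (1 + s) ^ (m - 1) = c) →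
      (∀ s ∈ Icc 0 τ, HasDerivWithinAt F (F' s) (Icc 0 τ) s) → ContinuousOn F' (Icc 0 τ) →
      ((∫ s in (0 : ℝ)..τ, (-(deriv (timeWeight m (j + 2) τ) s * F' s)
          + b s * timeWeight m (j + 2) τ s * F' s)) + timeWeight m (j + 2) τ τ * F' τ =
        timeWeight m (j + 2) τ 0 * F₁ + ∫ s in (0 : ℝ)..τ, timeWeight m (j + 2) τ s * H s) →
      F₁ + c * F 0 + ∫ s in (0 : ℝ)..τ, timeWeight m (j + 2) τ s * H s ≤
        C * τ ^ γ * ∫ s in (τ / 2)..τ, |F s| * timeCutoff (s / τ) ^ j := by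
  obtain ⟨C, hC, hCle⟩ := exists_abs_testDeriv_le (m := m) (c := c) (γ := γ) j hm hc h₁ h₂
  refine ⟨C, hC, fun τ hτ F F' b H F₁ hb hF hF' hid => ?_⟩
  have hτ0 : 0 < τ := by linarith
  -- For the weight `ρ`, this is `b ρ - ρ'` rewritten with the hypothesis on `b`. It is constant on
  -- `[0, τ / 2]` and zero at `τ`, so integrating by parts yields `c * F 0` and an error on `[τ / 2,
  -- τ]` only.
  set θ : ℝ → ℝ := fun s => c * timeCutoff (s / τ) ^ (j + 2) -
      (1 + s) ^ m * ((j + 2) * timeCutoff (s / τ) ^ (j + 1) * (deriv timeCutoff (s / τ) / τ)) with hθ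
  have e1 : ∫ s in (0 : ℝ)..τ, (-(deriv (timeWeight m (j + 2) τ) s * F' s)
          + b s * timeWeight m (j + 2) τ s * F' s) = ∫ s in (0 : ℝ)..τ, θ s * F' s := by
    refine intervalIntegral.integral_congr fun s hs => ?_
    rw [uIcc_of_le hτ0.le] at hs
    have := hasDerivAt_timeWeight m (j + 1) τ hs.1
    simp only [this.deriv, hθ, timeWeight]
    rw [← hb s hs]
    push_cast
    ring
  have hcF : ContinuousOn F (Icc 0 τ) := fun s hs => (hF s hs).continuousWithinAt
  have e2 : ∫ s in (0 : ℝ)..τ, θ s * F' s =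
      θ τ * F τ - θ 0 * F 0 - ∫ s in (0 : ℝ)..τ, testDeriv m c j τ s * F s := by
    refine intervalIntegral.integral_mul_deriv_eq_deriv_mul_of_hasDerivWithinAt ?_ ?_ ?_ ?_
    · intro s hs
      rw [uIcc_of_le hτ0.le] at hs
      exact (hasDerivAt_testDeriv m c j τ hs.1).hasDerivWithinAt
    · rw [uIcc_of_le hτ0.le]; exact hF
    · exact (continuousOn_testDeriv m c j τ).intervalIntegrable_of_Icc hτ0.le
    · exact hF'.intervalIntegrable_of_Icc hτ0.le
  have eθτ : θ τ = 0 := by simp [hθ, div_self hτ0.ne', timeCutoff_one]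
  have eθ0 : θ 0 = c := by
    simp [hθ, deriv_timeCutoff_of_lt (show (0 : ℝ) < 1 / 2 by norm_num),
      timeCutoff_of_le (show (0 : ℝ) ≤ 1 / 2 by norm_num)]
  have eρτ : timeWeight m (j + 2) τ τ = 0 := by
    simp [timeWeight, div_self hτ0.ne', timeCutoff_one]
  have eρ0 : timeWeight m (j + 2) τ 0 = 1 := by
    simp [timeWeight, timeCutoff_of_le (show (0 : ℝ) ≤ 1 / 2 by norm_num)]
  rw [e1, e2, eθτ, eθ0, eρτ, eρ0] at hid
  have e3 : ∫ s in (0 : ℝ)..τ, testDeriv m c j τ s * F s =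
      ∫ s in (τ / 2)..τ, testDeriv m c j τ s * F s := by
    have hcont : ContinuousOn (fun s => testDeriv m c j τ s * F s) (Icc 0 τ) :=
      (continuousOn_testDeriv m c j τ).mul hcF
    rw [← intervalIntegral.integral_add_adjacent_intervals (b := τ / 2)
      ((hcont.mono (Icc_subset_Icc le_rfl (by linarith))).intervalIntegrable_of_Icc (by linarith))
      ((hcont.mono (Icc_subset_Icc (by linarith) le_rfl)).intervalIntegrable_of_Icc (by linarith))]
    have : ∫ s in (0 : ℝ)..(τ / 2), testDeriv m c j τ s * F s = 0 := by
      rw [intervalIntegral.integral_of_le (by linarith), integral_Ioc_eq_integral_Ioo]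
      exact setIntegral_eq_zero_of_forall_eq_zero fun s hs => by
        rw [testDeriv_of_lt m c j hτ0 hs.2, zero_mul]
    rw [this, zero_add]
  have hsub : Icc (τ / 2) τ ⊆ Icc 0 τ := Icc_subset_Icc (by linarith) le_rfl
  have h3 : -∫ s in (τ / 2)..τ, testDeriv m c j τ s * F s ≤
      ∫ s in (τ / 2)..τ, C * τ ^ γ * (|F s| * timeCutoff (s / τ) ^ j) := by
    rw [← intervalIntegral.integral_neg]
    refine intervalIntegral.integral_mono_on (by linarith) ?_ ?_ fun s hs => ?_
    · exact ((((continuousOn_testDeriv m c j τ).mul hcF).mono hsub).neg).intervalIntegrable_of_Icc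
        (by linarith)
    · refine ContinuousOn.intervalIntegrable_of_Icc (by linarith) ?_
      exact continuousOn_const.mul ((hcF.mono hsub).abs.mul
        ((continuous_timeCutoff_div τ).pow j).continuousOn)
    · calc -(testDeriv m c j τ s * F s) ≤ |testDeriv m c j τ s * F s| := neg_le_abs _
        _ = |testDeriv m c j τ s| * |F s| := abs_mul _ _
        _ ≤ C * τ ^ γ * timeCutoff (s / τ) ^ j * |F s| := by gcongr; exact hCle τ hτ s hs
        _ = _ := by ring
  rw [intervalIntegral.integral_const_mul] at h3
  rw [e3] at hid
  linarith

/-- Hölder in time against the constant `1`. The condition on `j` means `j p ≥ j + 2`; as the cutoff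
is at most `1`, its power `j p` is dominated by the power `j + 2` that stands in the tested forcing.
-/
lemma integral_abs_mul_timeCutoff_rpow_le {p N τ : ℝ} {j : ℕ} (hp : 1 < p)
    (hj : (2 : ℝ) ≤ j * (p - 1)) (hτ : 0 < τ) {F H : ℝ → ℝ}
    (hF : ContinuousOn F (Icc 0 τ)) (hH : IntervalIntegrable H volume 0 τ)
    (h : ∀ᵐ s ∂volume.restrict (Icc 0 τ), |F s| ^ p ≤ N * H s) :
    (∫ s in (τ / 2)..τ, |F s| * timeCutoff (s / τ) ^ j) ^ p ≤
      N * τ ^ (p - 1) * ∫ s in (τ / 2)..τ, timeCutoff (s / τ) ^ (j + 2) * H s := by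
  have hsub : Icc (τ / 2) τ ⊆ Icc 0 τ := Icc_subset_Icc (by linarith) le_rfl
  have hle : τ / 2 ≤ τ := by linarith
  set G : ℝ → ℝ := fun s => |F s| * timeCutoff (s / τ) ^ j
  have hG0 : ∀ s, 0 ≤ G s := fun s =>
    mul_nonneg (abs_nonneg _) (pow_nonneg (timeCutoff_nonneg _) _)
  have hGc : ContinuousOn G (Icc (τ / 2) τ) :=
    (hF.mono hsub).abs.mul ((continuous_timeCutoff_div τ).pow j).continuousOn
  have hp0 : ENNReal.ofReal p ≠ 0 := by simp; linarith
  have hq := (Real.HolderConjugate.conjExponent hp).symm.pos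
  have hGp : ContinuousOn (fun s => G s ^ p) (Icc (τ / 2) τ) :=
    hGc.rpow_const fun s _ => Or.inr (by linarith)
  have mG : MemLp G (ENNReal.ofReal p) (volume.restrict (Icc (τ / 2) τ)) := by
    rw [← integrable_norm_rpow_iff (hGc.aestronglyMeasurable measurableSet_Icc) hp0
      ENNReal.ofReal_ne_top, ENNReal.toReal_ofReal (by linarith)]
    exact (hGc.norm.rpow_const fun s _ => Or.inr (by linarith)).integrableOn_compact isCompact_Icc
  have m1 : MemLp (fun _ : ℝ => (1 : ℝ)) (ENNReal.ofReal p.conjExponent)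
      (volume.restrict (Icc (τ / 2) τ)) := memLp_const 1
  have h1 := integral_mul_rpow_le hp mG m1
  simp only [abs_one, mul_one, Real.one_rpow, abs_of_nonneg (hG0 _)] at h1
  have hvol : ∫ _ in Icc (τ / 2) τ, (1 : ℝ) ≤ τ := by
    simp
    constructor <;> linarith
  have hI : ∀ f : ℝ → ℝ, ∫ s in Icc (τ / 2) τ, f s = ∫ s in (τ / 2)..τ, f s := fun f => by
    rw [intervalIntegral.integral_of_le hle, integral_Icc_eq_integral_Ioc]
  have hHi : IntervalIntegrable (fun s => N * (timeCutoff (s / τ) ^ (j + 2) * H s)) volume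
      (τ / 2) τ := by
    refine (IntervalIntegrable.continuousOn_mul (hH.mono_set ?_)
      ((continuous_timeCutoff_div τ).pow (j + 2)).continuousOn).const_mul N
    rw [uIcc_of_le hle, uIcc_of_le hτ.le]
    exact hsub
  have h2 : ∫ s in (τ / 2)..τ, G s ^ p ≤
      N * ∫ s in (τ / 2)..τ, timeCutoff (s / τ) ^ (j + 2) * H s := by
    rw [← intervalIntegral.integral_const_mul]
    refine intervalIntegral.integral_mono_ae_restrict hle
      (hGp.intervalIntegrable_of_Icc hle) hHi ?_
    filter_upwards [ae_restrict_of_ae_restrict_of_subset hsub h] with s hs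
    have hz0 := timeCutoff_nonneg (s / τ)
    have hz1 := timeCutoff_le_one (s / τ)
    have hz : (timeCutoff (s / τ) ^ j) ^ p ≤ timeCutoff (s / τ) ^ (j + 2) := by
      have hj0 : j ≠ 0 := by rintro rfl; norm_num at hj
      rcases hz0.eq_or_lt with h0 | h0
      · rw [← h0, zero_pow hj0, Real.zero_rpow (by linarith)]
        positivity
      · rw [← Real.rpow_natCast, ← Real.rpow_mul hz0, ← Real.rpow_natCast]
        refine Real.rpow_le_rpow_of_exponent_ge h0 hz1 ?_
        push_cast
        linarith
    calc G s ^ p = |F s| ^ p * (timeCutoff (s / τ) ^ j) ^ p :=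
          Real.mul_rpow (abs_nonneg _) (by positivity)
      _ ≤ N * H s * timeCutoff (s / τ) ^ (j + 2) :=
          mul_le_mul hs hz (by positivity) ((Real.rpow_nonneg (abs_nonneg _) _).trans hs)
      _ = _ := by ring
  rw [hI, hI] at h1
  have h3 : 0 ≤ ∫ s in (τ / 2)..τ, G s ^ p :=
    intervalIntegral.integral_nonneg hle fun s _ => Real.rpow_nonneg (hG0 s) _
  calc _ ≤ _ := h1
    _ ≤ (N * ∫ s in (τ / 2)..τ, timeCutoff (s / τ) ^ (j + 2) * H s) * τ ^ (p - 1) := by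
        gcongr
        · exact h3.trans h2
    _ = _ := by ring

/-! ### Exponential growth of the pairing with the eigenfunction -/

/-- The integrating factor of the first order reduction of `F'' + μ / (1 + t) F' ≥ F`. -/
noncomputable def waveWeight (μ s : ℝ) : ℝ :=
  Real.exp (-s + μ / 2 * Real.log (1 + s) - 1 / 2 * (1 + s)⁻¹)

/-- The zeroth order coefficient of the first order reduction of `F'' + μ / (1 + t) F' ≥ F`. -/
noncomputable def waveCoeff (μ s : ℝ) : ℝ :=
  1 + μ / 2 * (1 + s)⁻¹ - 1 / 2 * ((1 + s)⁻¹) ^ 2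

lemma waveWeight_pos (μ s : ℝ) : 0 < waveWeight μ s := Real.exp_pos _

lemma contDiffOn_waveWeight (μ : ℝ) : ContDiffOn ℝ ∞ (waveWeight μ) (Ioi (-1)) := by
  intro s hs
  refine ContDiffAt.contDiffWithinAt ?_
  have h : (1 + s) ≠ 0 := by have := mem_Ioi.1 hs; intro h; linarith
  have h1 : ContDiffAt ℝ ∞ (fun s : ℝ => 1 + s) s := contDiffAt_const.add contDiffAt_id
  exact ((contDiffAt_id.neg.add (contDiffAt_const.mul (h1.log h))).sub
    (contDiffAt_const.mul (h1.inv h))).exp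

lemma hasDerivAt_one_add_inv {s : ℝ} (hs : 0 ≤ s) :
    HasDerivAt (fun s : ℝ => (1 + s)⁻¹) (-((1 + s)⁻¹) ^ 2) s := by
  have := ((hasDerivAt_id s).const_add 1).inv (by simp only [id]; intro h; linarith)
  refine this.congr_deriv ?_
  simp only [id, inv_pow]
  ring

lemma hasDerivAt_log_one_add {s : ℝ} (hs : 0 ≤ s) :
    HasDerivAt (fun s : ℝ => Real.log (1 + s)) ((1 + s)⁻¹) s := by
  have := ((hasDerivAt_id s).const_add 1).log (by simp only [id]; intro h; linarith)
  exact this.congr_deriv (by simp)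

lemma hasDerivAt_waveWeight (μ : ℝ) {s : ℝ} (hs : 0 ≤ s) :
    HasDerivAt (waveWeight μ) ((μ / (1 + s) - waveCoeff μ s) * waveWeight μ s) s := by
  have := (((hasDerivAt_id s).neg.add ((hasDerivAt_log_one_add hs).const_mul (μ / 2))).sub
    ((hasDerivAt_one_add_inv hs).const_mul (1 / 2))).exp
  refine this.congr_deriv ?_
  simp only [waveCoeff, waveWeight, id, Pi.neg_apply, Pi.add_apply, Pi.sub_apply, div_eq_mul_inv]
  ring

lemma hasDerivAt_waveCoeff (μ : ℝ) {s : ℝ} (hs : 0 ≤ s) :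
    HasDerivAt (waveCoeff μ) (-(μ / 2 * ((1 + s)⁻¹) ^ 2) + ((1 + s)⁻¹) ^ 3) s := by
  have h := hasDerivAt_one_add_inv hs
  have := ((h.const_mul (μ / 2)).const_add 1).sub ((h.pow 2).const_mul (1 / 2))
  refine this.congr_deriv ?_
  generalize (1 + s)⁻¹ = y
  norm_num
  ring

/-- This is the coefficient of `F` in the derivative of `(F' + k F) W`, with `k` and `W` the wave
coefficient and weight, once `F'' + μ / (1 + s) F' ≥ F` is inserted. The quadratic correction in
`waveCoeff` is what makes it nonnegative for every `μ`: without it the coefficient is `(μ ^ 2 / 4 -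
μ / 2) / (1 + s) ^ 2`, negative for `0 < μ < 2`. -/
lemma waveCoeff_deriv_nonneg (μ : ℝ) {s : ℝ} (hs : 0 ≤ s) :
    0 ≤ (-(μ / 2 * ((1 + s)⁻¹) ^ 2) + ((1 + s)⁻¹) ^ 3)
      + waveCoeff μ s * (μ / (1 + s) - waveCoeff μ s) + 1 := by
  have hy0 : 0 < (1 + s)⁻¹ := by positivity
  have hy1 : (1 + s)⁻¹ ≤ 1 := inv_le_one_of_one_le₀ (by linarith)
  simp only [waveCoeff, div_eq_mul_inv μ (1 + s)]
  set y := (1 + s)⁻¹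
  have : (-(μ / 2 * y ^ 2) + y ^ 3) + (1 + μ / 2 * y - 1 / 2 * y ^ 2) *
      (μ * y - (1 + μ / 2 * y - 1 / 2 * y ^ 2)) + 1 =
      y ^ 2 * ((μ / 2 - 1 / 2) ^ 2 + (3 / 4 - y ^ 2 / 4) + y) := by ring
  rw [this]
  have : 0 ≤ 3 / 4 - y ^ 2 / 4 := by nlinarith
  positivity

/-- The solution of the damped wave equation, tested with an eigenfunction of the Laplacian,
grows exponentially up to the polynomial loss caused by the damping. -/
lemma exists_exp_lower_bound {μ : ℝ} (hμ : 0 ≤ μ) :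
    ∃ δ, 0 < δ ∧ ∀ τ, 0 < τ → ∀ (F F' H : ℝ → ℝ) (F₁ : ℝ),
      (∀ s ∈ Icc 0 τ, HasDerivWithinAt F (F' s) (Icc 0 τ) s) → ContinuousOn F' (Icc 0 τ) →
      0 ≤ F₁ → 0 < F 0 → (∀ s, 0 ≤ H s) →
      (∀ t ∈ Ioc 0 τ, (∫ s in (0 : ℝ)..t, (-(deriv (waveWeight μ) s * F' s) - waveWeight μ s * F s)
          + μ / (1 + s) * waveWeight μ s * F' s) + waveWeight μ t * F' t =
        waveWeight μ 0 * F₁ + ∫ s in (0 : ℝ)..t, waveWeight μ s * H s) →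
      ∀ t ∈ Icc 0 τ, δ * F 0 * (Real.exp t * (1 + t) ^ (-(μ / 2))) ≤ F t := by
  set c₀ := waveCoeff μ 0 * waveWeight μ 0 with hc₀
  have hk0 : 0 < waveCoeff μ 0 := by simp [waveCoeff]; linarith
  have hc₀pos : 0 < c₀ := mul_pos hk0 (waveWeight_pos _ _)
  set δ := min 1 (c₀ / 2)
  have hδ : 0 < δ := lt_min one_pos (by positivity)
  refine ⟨δ * Real.exp (-1 / 2), by positivity,
    fun τ hτ F F' H F₁ hF hF' hF₁ hF0 hH hid => ?_⟩
  have hcF : ContinuousOn F (Icc 0 τ) := fun s hs => (hF s hs).continuousWithinAt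
  -- As long as `F ≥ 0`, the quantity `(F' + k F) W` stays above `c₀ F(0)`. The argument is run on
  -- the integrated identity, since no second derivative of `F` is available.
  have step : ∀ t ∈ Ioc 0 τ, (∀ s ∈ Icc 0 t, 0 ≤ F s) →
      c₀ * F 0 ≤ (F' t + waveCoeff μ t * F t) * waveWeight μ t := by
    intro t ht hpos
    have hsub : Icc 0 t ⊆ Icc 0 τ := Icc_subset_Icc le_rfl ht.2
    have hdW : ∀ s, 0 ≤ s → HasDerivAt (fun s => waveCoeff μ s * waveWeight μ s)
        (((-(μ / 2 * ((1 + s)⁻¹) ^ 2) + ((1 + s)⁻¹) ^ 3)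
          + waveCoeff μ s * (μ / (1 + s) - waveCoeff μ s)) * waveWeight μ s) s := fun s hs =>
      ((hasDerivAt_waveCoeff μ hs).mul (hasDerivAt_waveWeight μ hs)).congr_deriv (by ring)
    have cW : ContinuousOn (waveWeight μ) (Icc 0 t) := fun s hs =>
      (hasDerivAt_waveWeight μ hs.1).continuousAt.continuousWithinAt
    have cC : ContinuousOn (waveCoeff μ) (Icc 0 t) := fun s hs =>
      (hasDerivAt_waveCoeff μ hs.1).continuousAt.continuousWithinAt
    have cinv : ContinuousOn (fun s : ℝ => (1 + s)⁻¹) (Icc 0 t) := fun s hs =>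
      (hasDerivAt_one_add_inv hs.1).continuousAt.continuousWithinAt
    have cd : ContinuousOn (fun s => ((-(μ / 2 * ((1 + s)⁻¹) ^ 2) + ((1 + s)⁻¹) ^ 3)
          + waveCoeff μ s * (μ / (1 + s) - waveCoeff μ s)) * waveWeight μ s) (Icc 0 t) := by
      simp only [div_eq_mul_inv]
      fun_prop
    have hFt : ContinuousOn F (Icc 0 t) := hcF.mono hsub
    have hF't : ContinuousOn F' (Icc 0 t) := hF'.mono hsub
    have e2 : ∫ s in (0 : ℝ)..t, (waveCoeff μ s * waveWeight μ s) * F' s =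
        (waveCoeff μ t * waveWeight μ t) * F t - (waveCoeff μ 0 * waveWeight μ 0) * F 0
        - ∫ s in (0 : ℝ)..t, (((-(μ / 2 * ((1 + s)⁻¹) ^ 2) + ((1 + s)⁻¹) ^ 3)
          + waveCoeff μ s * (μ / (1 + s) - waveCoeff μ s)) * waveWeight μ s) * F s := by
      refine intervalIntegral.integral_mul_deriv_eq_deriv_mul_of_hasDerivWithinAt
        (u := fun s => waveCoeff μ s * waveWeight μ s) ?_ ?_ ?_ ?_
      · intro s hs
        rw [uIcc_of_le ht.1.le] at hs
        exact (hdW s hs.1).hasDerivWithinAt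
      · rw [uIcc_of_le ht.1.le]; exact fun s hs => (hF s (hsub hs)).mono hsub
      · exact cd.intervalIntegrable_of_Icc ht.1.le
      · exact hF't.intervalIntegrable_of_Icc ht.1.le
    have e1 : ∫ s in (0 : ℝ)..t, (-(deriv (waveWeight μ) s * F' s) - waveWeight μ s * F s)
          + μ / (1 + s) * waveWeight μ s * F' s =
        (∫ s in (0 : ℝ)..t, (waveCoeff μ s * waveWeight μ s) * F' s) -
          ∫ s in (0 : ℝ)..t, waveWeight μ s * F s := by
      rw [← intervalIntegral.integral_sub]
      · refine intervalIntegral.integral_congr fun s hs => ?_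
        rw [uIcc_of_le ht.1.le] at hs
        simp only [(hasDerivAt_waveWeight μ hs.1).deriv]
        ring
      · exact ((cC.mul cW).mul hF't).intervalIntegrable_of_Icc ht.1.le
      · exact (cW.mul hFt).intervalIntegrable_of_Icc ht.1.le
    have h3 : 0 ≤ ∫ s in (0 : ℝ)..t, waveWeight μ s * H s :=
      intervalIntegral.integral_nonneg ht.1.le fun s _ => mul_nonneg (waveWeight_pos _ _).le (hH s)
    have h4 : 0 ≤ (∫ s in (0 : ℝ)..t, (((-(μ / 2 * ((1 + s)⁻¹) ^ 2) + ((1 + s)⁻¹) ^ 3)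
          + waveCoeff μ s * (μ / (1 + s) - waveCoeff μ s)) * waveWeight μ s) * F s)
        + ∫ s in (0 : ℝ)..t, waveWeight μ s * F s := by
      rw [← intervalIntegral.integral_add]
      · refine intervalIntegral.integral_nonneg ht.1.le fun s hs => ?_
        have := mul_nonneg (mul_nonneg (waveCoeff_deriv_nonneg μ hs.1) (waveWeight_pos μ s).le)
          (hpos s hs)
        linarith
      · exact (cd.mul hFt).intervalIntegrable_of_Icc ht.1.le
      · exact (cW.mul hFt).intervalIntegrable_of_Icc ht.1.le
    have := hid t ht
    rw [e1, e2] at this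
    have h5 := mul_nonneg (waveWeight_pos μ 0).le hF₁
    simp only [hc₀]
    nlinarith
  -- A primitive of `waveCoeff`, so that the derivative of `e ^ K F` is `e ^ K (F' + k F)`; the
  -- previous step bounds it below by `c₀ F(0) e ^ (2 s)`.
  set K : ℝ → ℝ := fun s => s + μ / 2 * Real.log (1 + s) + 1 / 2 * (1 + s)⁻¹ with hK
  have dK : ∀ s, 0 ≤ s → HasDerivAt (fun s => Real.exp (K s))
      (Real.exp (K s) * waveCoeff μ s) s := by
    intro s hs
    have := (((hasDerivAt_id s).add ((hasDerivAt_log_one_add hs).const_mul (μ / 2))).add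
      ((hasDerivAt_one_add_inv hs).const_mul (1 / 2))).exp
    refine this.congr_deriv ?_
    simp only [waveCoeff, hK, id, Pi.add_apply]
    ring
  have hKW : ∀ s, 0 ≤ s → Real.exp (2 * s) * waveWeight μ s ≤ Real.exp (K s) := by
    intro s hs
    have hy0 : 0 < (1 + s)⁻¹ := by positivity
    rw [waveWeight, ← Real.exp_add]
    refine Real.exp_le_exp.2 ?_
    simp only [hK]
    linarith
  have mono : ∀ t ∈ Icc 0 τ, (∀ s ∈ Ico 0 t, 0 < F s) →
      δ * F 0 * Real.exp (2 * t) ≤ Real.exp (K t) * F t := by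
    intro t ht hpos
    have hsub : Icc 0 t ⊆ Icc 0 τ := Icc_subset_Icc le_rfl ht.2
    set D : ℝ → ℝ := fun s => Real.exp (K s) * F s - δ * F 0 * Real.exp (2 * s) with hD
    have dD : ∀ s ∈ Ioo 0 t, HasDerivAt D ((Real.exp (K s) * waveCoeff μ s) * F s
        + Real.exp (K s) * F' s - δ * F 0 * (Real.exp (2 * s) * 2)) s := by
      intro s hs
      have h1 : HasDerivAt F (F' s) s :=
        (hF s (hsub (Ioo_subset_Icc_self hs))).hasDerivAt
          (Icc_mem_nhds hs.1 (hs.2.trans_le ht.2))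
      have h2 := ((hasDerivAt_id s).const_mul (2 : ℝ)).exp
      exact (((dK s hs.1.le).mul h1).sub (h2.const_mul (δ * F 0))).congr_deriv (by simp)
    have cD : ContinuousOn D (Icc 0 t) := by
      have c1 : ContinuousOn (fun s => Real.exp (K s)) (Icc 0 t) := fun s hs =>
        (dK s hs.1).continuousAt.continuousWithinAt
      exact (c1.mul (hcF.mono hsub)).sub (by fun_prop)
    have hmono : MonotoneOn D (Icc 0 t) := by
      refine monotoneOn_of_deriv_nonneg (convex_Icc 0 t) cD ?_ ?_
      · intro s hs
        rw [interior_Icc] at hs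
        exact (dD s hs).differentiableAt.differentiableWithinAt
      · intro s hs
        rw [interior_Icc] at hs
        rw [(dD s hs).deriv]
        have hst := step s ⟨hs.1, hs.2.le.trans ht.2⟩
          fun r hr => (hpos r ⟨hr.1, hr.2.trans_lt hs.2⟩).le
        have hw := waveWeight_pos μ s
        have hc : c₀ * F 0 * Real.exp (2 * s) ≤
            (F' s + waveCoeff μ s * F s) * Real.exp (K s) := by
          have hZ : 0 ≤ F' s + waveCoeff μ s * F s := by
            have : 0 < (F' s + waveCoeff μ s * F s) * waveWeight μ s :=
              (mul_pos hc₀pos hF0).trans_le hst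
            exact (pos_of_mul_pos_left this hw.le).le
          calc c₀ * F 0 * Real.exp (2 * s)
              ≤ (F' s + waveCoeff μ s * F s) * waveWeight μ s * Real.exp (2 * s) := by gcongr
            _ = (F' s + waveCoeff μ s * F s) * (Real.exp (2 * s) * waveWeight μ s) := by ring
            _ ≤ _ := by gcongr; exact hKW s hs.1.le
        have hδ2 : δ * 2 ≤ c₀ := by have := min_le_right 1 (c₀ / 2); simp only [δ]; linarith
        have : δ * 2 * (F 0 * Real.exp (2 * s)) ≤ c₀ * (F 0 * Real.exp (2 * s)) := by gcongr
        nlinarith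
    have h0 := hmono (left_mem_Icc.2 ht.1) (right_mem_Icc.2 ht.1) ht.1
    have hD0 : 0 ≤ D 0 := by
      have h1 : 1 ≤ Real.exp (K 0) := Real.one_le_exp (by simp [hK])
      have h2 : δ ≤ 1 := min_le_left _ _
      simp only [hD, mul_zero, Real.exp_zero, mul_one]
      nlinarith
    have := hD0.trans h0
    simp only [hD] at this
    linarith
  -- Removes the sign assumption: at a first time with `F ≤ 0` the lower bound from the past would
  -- already force `F > 0`.
  have hpos : ∀ t ∈ Icc 0 τ, 0 < F t := by
    by_contra! hcon
    set S := {t ∈ Icc 0 τ | F t ≤ 0}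
    have hSne : S.Nonempty := hcon
    have hSc : IsClosed S := hcF.preimage_isClosed_of_isClosed isClosed_Icc isClosed_Iic
    have hSk : IsCompact S := isCompact_Icc.of_isClosed_subset hSc (sep_subset _ _)
    obtain ⟨t₁, ht₁, hmin⟩ := hSk.exists_isLeast hSne
    have := mono t₁ ht₁.1 fun s hs => by
      by_contra! h
      exact absurd (hmin ⟨⟨hs.1, hs.2.le.trans ht₁.1.2⟩, h⟩) (not_le.2 hs.2)
    have h1 : 0 < Real.exp (K t₁) * F t₁ := lt_of_lt_of_le (by positivity) this
    exact absurd (pos_of_mul_pos_right h1 (Real.exp_pos _).le) (not_lt.2 ht₁.2)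
  intro t ht
  have h1 := mono t ht fun s hs => hpos s ⟨hs.1, hs.2.le.trans ht.2⟩
  have ht1 : 0 < 1 + t := by linarith [ht.1]
  have hy : (1 + t)⁻¹ ≤ 1 := inv_le_one_of_one_le₀ (by linarith [ht.1])
  have h2 : Real.exp (-1 / 2) * (Real.exp t * (1 + t) ^ (-(μ / 2))) * Real.exp (K t) ≤
      Real.exp (2 * t) := by
    rw [Real.rpow_def_of_pos ht1, ← Real.exp_add, ← Real.exp_add, ← Real.exp_add]
    refine Real.exp_le_exp.2 ?_
    simp only [hK]
    linarith
  have h3 : δ * F 0 * (Real.exp (-1 / 2) * (Real.exp t * (1 + t) ^ (-(μ / 2))) * Real.exp (K t)) ≤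
      Real.exp (K t) * F t := (mul_le_mul_of_nonneg_left h2 (by positivity)).trans h1
  have := Real.exp_pos (K t)
  refine le_of_mul_le_mul_right ?_ this
  linarith

/-! ### Estimates for a solution tested with cutoffs -/

/-- A nonnegative compactly supported smooth function which is `1` on the ball of radius `r`. -/
def IsSpaceCutoff (r : ℝ) (χ : E n → ℝ) : Prop :=
  ContDiff ℝ ∞ χ ∧ HasCompactSupport χ ∧ (∀ x, 0 ≤ χ x) ∧ ∀ x ∈ Metric.ball (0 : E n) r, χ x = 1

lemma exists_isSpaceCutoff (n : ℕ) {r : ℝ} (hr : 0 < r) : ∃ χ : E n → ℝ, IsSpaceCutoff r χ := by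
  let f : ContDiffBump (0 : E n) := ⟨r, r + 1, hr, by linarith⟩
  exact ⟨f, f.contDiff, f.hasCompactSupport, f.nonneg', fun x hx =>
    f.one_of_mem_closedBall (Metric.ball_subset_closedBall hx)⟩

lemma IsSpaceCutoff.eventuallyEq {r : ℝ} {χ : E n → ℝ} (h : IsSpaceCutoff r χ) {x : E n}
    (hx : ‖x‖ < r) : χ =ᶠ[𝓝 x] fun _ => 1 := by
  filter_upwards [Metric.isOpen_ball.mem_nhds (mem_ball_zero_iff.2 hx)] with y hy using h.2.2.2 y hy

lemma IsSpaceCutoff.lap_eq {r : ℝ} {χ : E n → ℝ} (h : IsSpaceCutoff r χ) {x : E n}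
    (hx : ‖x‖ < r) : lap χ x = 0 := by
  rw [lap_congr (h.eventuallyEq hx), lap_const]

/-- The eigenfunction is not compactly supported, but its truncation is indistinguishable from it on
the ball that contains the solution. -/
lemma IsSpaceCutoff.lap_mul_radialEigenfunction (hn : 1 ≤ n) {r : ℝ} {χ : E n → ℝ}
    (h : IsSpaceCutoff r χ) {x : E n} (hx : ‖x‖ < r) :
    lap (fun y => χ y * radialEigenfunction y) x = χ x * radialEigenfunction x := by
  have e : (fun y => χ y * radialEigenfunction y) =ᶠ[𝓝 x] radialEigenfunction := by
    filter_upwards [h.eventuallyEq hx] with y hy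
    rw [hy, one_mul]
  rw [lap_congr e, lap_radialEigenfunction hn, h.2.2.2 x (mem_ball_zero_iff.2 hx), one_mul]

lemma SupportedInBall.integral_mul_congr {r : ℝ} {f φ ψ : E n → ℝ} (hf : SupportedInBall r f)
    (h : ∀ x, ‖x‖ ≤ r → φ x = ψ x) : ∫ x, f x * φ x = ∫ x, f x * ψ x := by
  refine integral_congr_ae ?_
  filter_upwards [hf] with x hx
  rcases le_or_gt ‖x‖ r with h1 | h1
  · rw [h x h1]
  · rw [hx h1, zero_mul, zero_mul]

lemma mem_timeDomain {T : EReal} {τ : ℝ} (hτ : (τ : EReal) < T) {s : ℝ} (hs : s ∈ Icc 0 τ) :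
    s ∈ timeDomain T :=
  ⟨hs.1, lt_of_le_of_lt (EReal.coe_le_coe_iff.2 hs.2) hτ⟩

lemma C1L1loc.hasDerivWithinAt_Icc {T : EReal} {w wt : ℝ → E n → ℝ} (hw : C1L1loc T w wt)
    {φ : E n → ℝ} (hφ : Continuous φ) (hc : HasCompactSupport φ) {τ : ℝ} (hτ : (τ : EReal) < T)
    {s : ℝ} (hs : s ∈ Icc 0 τ) :
    HasDerivWithinAt (fun s => ∫ x, w s x * φ x) (∫ x, wt s x * φ x) (Icc 0 τ) s :=
  (hw.hasDerivWithinAt_integral_mul hφ hc (mem_timeDomain hτ hs)).mono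
    fun _ hr => mem_timeDomain hτ hr

lemma ContL1loc.continuousOn_Icc {T : EReal} {f : ℝ → E n → ℝ} (hf : ContL1loc T f)
    {φ : E n → ℝ} (hφ : Continuous φ) (hc : HasCompactSupport φ) {τ : ℝ} (hτ : (τ : EReal) < T) :
    ContinuousOn (fun s => ∫ x, f s x * φ x) (Icc 0 τ) :=
  (hf.continuousOn_integral_mul hφ hc).mono fun _ hr => mem_timeDomain hτ hr

/-- The functional inequality for the spatial averages of a solution. -/
lemma exists_solution_functional_bound (n : ℕ) {m c γ : ℝ} (R : ℝ) (j : ℕ) (hm : 0 ≤ m)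
    (hc : 0 ≤ c) (h₁ : m - 2 ≤ γ) (h₂ : c = 0 ∨ -1 ≤ γ) :
    ∃ C, 0 < C ∧ ∀ (T : EReal) (τ r : ℝ) (χ : E n → ℝ), 1 ≤ τ → (τ : EReal) < T → R + τ < r →
      IsSpaceCutoff r χ → ∀ (b : ℝ → ℝ) (w₁ : E n → ℝ) (w wt : ℝ → E n → ℝ) (g : ℝ → E n → E n)
      (h : ℝ → E n → ℝ), SatisfiesDampedWave T b w₁ wt g h → ContW11loc T w g → C1L1loc T w wt →
      (∀ s ∈ Ioc 0 τ, SupportedInBall (R + s) (w s)) →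
      (∀ s ∈ Icc 0 τ, b s * (1 + s) ^ m - m * (1 + s) ^ (m - 1) = c) →
      (∫ x, w₁ x * χ x) + c * (∫ x, w 0 x * χ x)
          + ∫ s in (0 : ℝ)..τ, timeWeight m (j + 2) τ s * ∫ x, h s x * χ x ≤
        C * τ ^ γ * ∫ s in (τ / 2)..τ, |∫ x, w s x * χ x| * timeCutoff (s / τ) ^ j := by
  obtain ⟨C, hC, hCle⟩ := exists_weighted_functional_bound (m := m) (c := c) (γ := γ) j hm hc h₁ h₂
  refine ⟨C, hC, fun T τ r χ hτ hτT hr hχ b w₁ w wt g h hS hW hw hsupp hb => ?_⟩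
  have hτ0 : 0 < τ := by linarith
  refine hCle τ hτ (fun s => ∫ x, w s x * χ x) (fun s => ∫ x, wt s x * χ x) b
    (fun s => ∫ x, h s x * χ x) (∫ x, w₁ x * χ x) hb
    (fun s hs => hw.hasDerivWithinAt_Icc hχ.1.continuous hχ.2.1 hτT hs)
    (hw.2.1.continuousOn_Icc hχ.1.continuous hχ.2.1 hτT) ?_
  rw [← hS.integral_mul_eq hW hw hχ.1 hχ.2.1 (contDiffOn_timeWeight m (j + 2) τ) hτ0 hτT]
  congr 1
  refine intervalIntegral.integral_congr_ae (ae_of_all _ fun s hs => ?_)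
  rw [uIoc_of_le hτ0.le] at hs
  have : ∫ x, w s x * lap χ x = ∫ x, w s x * (fun _ : E n => (0 : ℝ)) x :=
    (hsupp s hs).integral_mul_congr fun x hx => hχ.lap_eq (by linarith [hs.2])
  simp only [this, mul_zero, integral_zero, sub_zero]

/-- Hölder's inequality in space and time for the spatial averages of a solution. -/
lemma exists_average_rpow_le (n : ℕ) {p R : ℝ} {j : ℕ} (hp : 1 < p) (hR : 0 < R)
    (hj : (2 : ℝ) ≤ j * (p - 1)) :
    ∃ C, 0 < C ∧ ∀ (T : EReal) (τ r : ℝ) (χ : E n → ℝ), 1 ≤ τ → (τ : EReal) < T → R + τ < r →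
      IsSpaceCutoff r χ → ∀ w : ℝ → E n → ℝ, ContL1loc T w → MemLrloc T p w →
      (∀ s ∈ Ioc 0 τ, SupportedInBall (R + s) (w s)) →
      (∫ s in (τ / 2)..τ, |∫ x, w s x * χ x| * timeCutoff (s / τ) ^ j) ^ p ≤
        C * τ ^ (((n : ℝ) + 1) * (p - 1)) *
          ∫ s in (τ / 2)..τ, timeCutoff (s / τ) ^ (j + 2) * ∫ x, |w s x| ^ p * χ x := by
  set V := (volume : Measure (E n)).real (Metric.ball 0 1)
  have hV : 0 < V := ENNReal.toReal_pos (Metric.measure_ball_pos volume 0 one_pos).ne'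
    measure_ball_lt_top.ne
  refine ⟨((R + 1) ^ n * V) ^ (p - 1), by positivity, fun T τ r χ hτ hτT hr hχ w hw hwp hsupp => ?_⟩
  have hτ0 : 0 < τ := by linarith
  -- `N` is the `(p - 1)`-th power of a bound for the volume of the ball of radius `R + s`, using `R
  -- + s ≤ (R + 1) τ` from `1 ≤ τ`.
  have key := integral_abs_mul_timeCutoff_rpow_le (N := (((R + 1) * τ) ^ n * V) ^ (p - 1)) hp hj hτ0
    (hw.continuousOn_Icc hχ.1.continuous hχ.2.1 hτT)
    (hwp.intervalIntegrable (by linarith) hτ0.le hτT hχ.1.continuous hχ.2.1) ?_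
  · refine key.trans (le_of_eq ?_)
    congr 1
    rw [mul_pow, mul_right_comm, Real.mul_rpow (by positivity) (by positivity), mul_assoc,
      ← Real.rpow_natCast τ n, ← Real.rpow_mul hτ0.le, ← Real.rpow_add hτ0]
    congr 2
    ring
  · filter_upwards [hwp.ae_integrableOn (by linarith) hτT hχ.2.1,
      ae_restrict_mem measurableSet_Icc, Measure.ae_ne (volume.restrict (Icc 0 τ)) 0]
      with s hs hsI hs0
    have hs' : s ∈ Ioc 0 τ := ⟨lt_of_le_of_ne hsI.1 (Ne.symm hs0), hsI.2⟩
    have hRs : 0 ≤ R + s := by linarith [hsI.1]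
    have hball : ∀ x ∈ Metric.closedBall (0 : E n) (R + s), χ x = 1 := fun x hx =>
      hχ.2.2.2 x (mem_ball_zero_iff.2 (by
        have := mem_closedBall_zero_iff.1 hx
        linarith [hsI.2]))
    have h1 := abs_integral_mul_rpow_le hp (hw.1 s (mem_timeDomain hτT hsI)).aestronglyMeasurable
      (hsupp s hs') hχ.1.continuous hχ.1.continuous hχ.2.1 hχ.2.2.1 hball hs
    rw [mul_comm] at h1
    refine h1.trans ?_
    have h2 : 0 ≤ ∫ x, |w s x| ^ p * χ x :=
      integral_nonneg fun x => mul_nonneg (Real.rpow_nonneg (abs_nonneg _) _) (hχ.2.2.1 x)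
    have h3 : ∫ x in Metric.closedBall (0 : E n) (R + s), |χ x| ^ p.conjExponent =
        (R + s) ^ n * V := by
      rw [setIntegral_congr_fun Metric.isClosed_closedBall.measurableSet
        (g := fun _ => (1 : ℝ)) fun x hx => by simp [hball x hx]]
      rw [setIntegral_const, Measure.addHaar_real_closedBall _ _ hRs, finrank_euclideanSpace_fin]
      simp [V]
    rw [h3]
    have h4 : R + s ≤ (R + 1) * τ := by nlinarith [hsI.2]
    gcongr

lemma rpow_neg_abs_le_rpow {L x : ℝ} (e : ℝ) (hL : 1 ≤ L) (hx₁ : L⁻¹ ≤ x) (hx₂ : x ≤ L) :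
    L ^ (-|e|) ≤ x ^ e := by
  have hL0 : 0 < L := by linarith
  have hx0 : 0 < x := (inv_pos.2 hL0).trans_le hx₁
  rcases le_total 0 e with he | he
  · rw [abs_of_nonneg he, Real.rpow_neg hL0.le, ← Real.inv_rpow hL0.le]
    exact Real.rpow_le_rpow (by positivity) hx₁ he
  · rw [abs_of_nonpos he, neg_neg]
    exact Real.rpow_le_rpow_of_nonpos hx0 hx₂ he

/-- The lower bound for the nonlinearity coming from the linear wave part of the equation. -/
lemma exists_ae_forcing_lower_bound (hn : 1 ≤ n) {p μ R : ℝ} (hp : 1 < p) (hμ : 0 ≤ μ)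
    (hR : 0 < R) :
    ∃ C, 0 < C ∧ ∀ (T : EReal) (τ r : ℝ) (χ : E n → ℝ), 0 < τ → (τ : EReal) < T → R + τ < r →
      IsSpaceCutoff r χ → ∀ (w₁ : E n → ℝ) (w wt : ℝ → E n → ℝ) (g : ℝ → E n → E n)
      (h : ℝ → E n → ℝ), SatisfiesDampedWave T (fun t => μ / (1 + t)) w₁ wt g h →
      ContW11loc T w g → C1L1loc T w wt → MemLrloc T p w →
      (∀ s ∈ Ioc 0 τ, SupportedInBall (R + s) (w s)) → (∀ s x, 0 ≤ h s x) → (∀ᵐ x, 0 ≤ w₁ x) →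
      (∀ᵐ x, 0 ≤ w 0 x) → 0 < ∫ x, w 0 x * χ x →
      ∀ᵐ s ∂volume.restrict (Icc 0 τ), C * (∫ x, w 0 x * χ x) ^ p *
        (1 + s) ^ ((n : ℝ) - 1 - p * (n - 1 + μ) / 2) ≤ ∫ x, |w s x| ^ p * χ x := by
  obtain ⟨δ, hδ, hF⟩ := exists_exp_lower_bound hμ
  have hq := (Real.HolderConjugate.conjExponent hp).symm.pos
  obtain ⟨B, hB, hΦ⟩ := exists_integral_radialEigenfunction_le hn hq
  have hp0 : p ≠ 0 := by linarith
  have hp1 : p - 1 ≠ 0 := by linarith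
  set α := ((n : ℝ) - 1) * (1 - p.conjExponent / 2)
  -- Together with `hqp`: the dual norm of the eigenfunction enters as a multiple of `(1 + s) ^ (α
  -- (p - 1)) e ^ (p s)`, and this exponential cancels the one in the lower bound for `F(s) ^ p`.
  have hα : α * (p - 1) = ((n : ℝ) - 1) * (p / 2 - 1) := by
    simp only [α, Real.conjExponent]; field_simp; ring
  have hqp : p.conjExponent * (p - 1) = p := by
    simp only [Real.conjExponent]; field_simp
  refine ⟨δ ^ p / (B ^ (p - 1) * Real.exp (p * R) * (1 + R) ^ |α * (p - 1)|), by positivity,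
    fun T τ r χ hτ hτT hr hχ w₁ w wt g h hS hW hw hwp hsupp hh hw₁ hw0 hJ => ?_⟩
  set φ : E n → ℝ := fun x => χ x * radialEigenfunction x
  have hφ : ContDiff ℝ ∞ φ := hχ.1.mul (contDiff_radialEigenfunction hn)
  have hφc : HasCompactSupport φ := hχ.2.1.mul_right
  have hφ0 : ∀ x, 0 ≤ φ x := fun x =>
    mul_nonneg (hχ.2.2.1 x) (zero_le_one.trans (one_le_radialEigenfunction hn x))
  set F : ℝ → ℝ := fun s => ∫ x, w s x * φ x with hFdef
  have h0mem : (0 : ℝ) ∈ timeDomain T := mem_timeDomain hτT (left_mem_Icc.2 hτ.le)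
  have hF0 : ∫ x, w 0 x * χ x ≤ F 0 := by
    refine integral_mono_ae
      (integrable_mul_of_hasCompactSupport (hw.1.1 0 h0mem) hχ.1.continuous hχ.2.1)
      (integrable_mul_of_hasCompactSupport (hw.1.1 0 h0mem) hφ.continuous hφc) ?_
    filter_upwards [hw0] with x hx
    exact mul_le_mul_of_nonneg_left
      (le_mul_of_one_le_right (hχ.2.2.1 x) (one_le_radialEigenfunction hn x)) hx
  have hFlow := hF τ hτ F (fun s => ∫ x, wt s x * φ x) (fun s => ∫ x, h s x * φ x)
    (∫ x, w₁ x * φ x)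
    (fun s hs => hw.hasDerivWithinAt_Icc hφ.continuous hφc hτT hs)
    (hw.2.1.continuousOn_Icc hφ.continuous hφc hτT)
    (integral_nonneg_of_ae (by filter_upwards [hw₁] with x hx using mul_nonneg hx (hφ0 x)))
    (hJ.trans_le hF0) (fun s => integral_nonneg fun x => mul_nonneg (hh s x) (hφ0 x))
    (fun t ht => by
      rw [← hS.integral_mul_eq hW hw hφ hφc (contDiffOn_waveWeight μ) ht.1
        (lt_of_le_of_lt (EReal.coe_le_coe_iff.2 ht.2) hτT)]
      congr 1
      refine intervalIntegral.integral_congr_ae (ae_of_all _ fun s hs => ?_)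
      rw [uIoc_of_le ht.1.le] at hs
      have hs' : s ∈ Ioc 0 τ := ⟨hs.1, hs.2.trans ht.2⟩
      have : ∫ x, w s x * lap φ x = F s :=
        (hsupp s hs').integral_mul_congr fun x hx =>
          hχ.lap_mul_radialEigenfunction hn (by linarith [hs'.2])
      rw [this])
  filter_upwards [hwp.ae_integrableOn (by linarith) hτT hχ.2.1,
    ae_restrict_mem measurableSet_Icc, Measure.ae_ne (volume.restrict (Icc 0 τ)) 0]
    with s hs hsI hs0
  have hs' : s ∈ Ioc 0 τ := ⟨lt_of_le_of_ne hsI.1 (Ne.symm hs0), hsI.2⟩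
  have hs1 : 0 < 1 + s := by linarith [hsI.1]
  have hRs : 0 ≤ R + s := by linarith [hsI.1]
  have hball : ∀ x ∈ Metric.closedBall (0 : E n) (R + s), χ x = 1 := fun x hx =>
    hχ.2.2.2 x (mem_ball_zero_iff.2 (by
      have := mem_closedBall_zero_iff.1 hx
      linarith [hsI.2]))
  have h1 := abs_integral_mul_rpow_le hp (hw.1.1 s (mem_timeDomain hτT hsI)).aestronglyMeasurable
    (hsupp s hs') hφ.continuous hχ.1.continuous hχ.2.1 hχ.2.2.1 hball hs
  have h3 : ∫ x in Metric.closedBall (0 : E n) (R + s), |φ x| ^ p.conjExponent ≤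
      B * ((1 + (R + s)) ^ α * Real.exp (p.conjExponent * (R + s))) := by
    refine le_trans (le_of_eq ?_) (hΦ (R + s) hRs)
    refine setIntegral_congr_fun Metric.isClosed_closedBall.measurableSet fun x hx => ?_
    simp only [φ, hball x hx, one_mul]
    rw [abs_of_nonneg (zero_le_one.trans (one_le_radialEigenfunction hn x))]
  set J := ∫ x, w 0 x * χ x
  set A := ∫ x, |w s x| ^ p * χ x
  have hA : 0 ≤ A :=
    integral_nonneg fun x => mul_nonneg (Real.rpow_nonneg (abs_nonneg _) _) (hχ.2.2.1 x)
  have h4 : (∫ x in Metric.closedBall (0 : E n) (R + s), |φ x| ^ p.conjExponent) ^ (p - 1) ≤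
      B ^ (p - 1) * (1 + (R + s)) ^ (α * (p - 1)) * (Real.exp (p * R) * Real.exp (p * s)) := by
    have h5 := Real.rpow_le_rpow (integral_nonneg fun x => by positivity) h3
      (by linarith : 0 ≤ p - 1)
    refine h5.trans (le_of_eq ?_)
    rw [Real.mul_rpow hB.le (by positivity), Real.mul_rpow (by positivity) (Real.exp_pos _).le,
      ← Real.rpow_mul (by linarith), ← Real.exp_mul, ← Real.exp_add]
    rw [show p.conjExponent * (R + s) * (p - 1) = p * R + p * s by
      rw [mul_right_comm, hqp]; ring]
    ring
  have h6 : (1 + (R + s)) ^ (α * (p - 1)) ≤ (1 + R) ^ |α * (p - 1)| * (1 + s) ^ (α * (p - 1)) := by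
    have hx1 : (1 + R)⁻¹ ≤ (1 + s) / (1 + (R + s)) := by
      rw [inv_eq_one_div, div_le_div_iff₀ (by linarith) (by linarith)]
      nlinarith [hsI.1]
    have hx2 : (1 + s) / (1 + (R + s)) ≤ 1 + R := by
      rw [div_le_iff₀ (by linarith)]; nlinarith [hsI.1]
    have h7 := rpow_neg_abs_le_rpow (α * (p - 1)) (by linarith : 1 ≤ 1 + R) hx1 hx2
    rw [Real.div_rpow hs1.le (by linarith), Real.rpow_neg (by linarith)] at h7
    have hpos : 0 < (1 + (R + s)) ^ (α * (p - 1)) := Real.rpow_pos_of_pos (by linarith) _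
    rw [le_div_iff₀ hpos, inv_mul_le_iff₀ (by positivity)] at h7
    exact h7
  have h8 : (δ * J * (Real.exp s * (1 + s) ^ (-(μ / 2)))) ^ p ≤ |F s| ^ p := by
    refine Real.rpow_le_rpow (by positivity) ?_ (by linarith)
    refine le_trans ?_ ((hFlow s hsI).trans (le_abs_self _))
    gcongr
  have h9 : (δ * J * (Real.exp s * (1 + s) ^ (-(μ / 2)))) ^ p =
      δ ^ p * J ^ p * (Real.exp (p * s) * (1 + s) ^ (-(p * μ / 2))) := by
    rw [Real.mul_rpow (by positivity) (by positivity), Real.mul_rpow hδ.le hJ.le,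
      Real.mul_rpow (Real.exp_pos _).le (by positivity), ← Real.exp_mul, ← Real.rpow_mul hs1.le]
    rw [mul_comm s p]
    congr 3
    ring
  rw [h9] at h8
  have h10 : δ ^ p * J ^ p * (1 + s) ^ (-(p * μ / 2)) ≤
      A * (B ^ (p - 1) * ((1 + R) ^ |α * (p - 1)| * (1 + s) ^ (α * (p - 1))) * Real.exp (p * R)) := by
    have h11 := h8.trans (h1.trans (mul_le_mul_of_nonneg_left h4 hA))
    have he := Real.exp_pos (p * s)
    have h12 : δ ^ p * J ^ p * (1 + s) ^ (-(p * μ / 2)) * Real.exp (p * s) ≤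
        A * (B ^ (p - 1) * (1 + (R + s)) ^ (α * (p - 1)) * Real.exp (p * R)) * Real.exp (p * s) := by
      linarith
    refine (le_of_mul_le_mul_right h12 he).trans ?_
    gcongr
  have hexp : (n : ℝ) - 1 - p * (n - 1 + μ) / 2 = -(p * μ / 2) - α * (p - 1) := by
    rw [hα]; ring
  rw [hexp, Real.rpow_sub hs1, div_mul_eq_mul_div, div_mul_div_comm, div_le_iff₀ (by positivity)]
  refine h10.trans (le_of_eq ?_)
  ring

/-- It suffices to integrate the pointwise bound over `[τ / 4, τ / 2]`, where the cutoff equals `1`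
and `1 + s` is comparable to `τ`; the length of the interval contributes the additional power of
`τ`. -/
lemma exists_forcing_lower_bound (hn : 1 ≤ n) {p μ R : ℝ} (k : ℕ) (hp : 1 < p) (hμ : 0 ≤ μ)
    (hR : 0 < R) :
    ∃ C, 0 < C ∧ ∀ (T : EReal) (τ r : ℝ) (χ : E n → ℝ), 1 ≤ τ → (τ : EReal) < T → R + τ < r →
      IsSpaceCutoff r χ → ∀ (w₁ : E n → ℝ) (w wt : ℝ → E n → ℝ) (g : ℝ → E n → E n)
      (h : ℝ → E n → ℝ), SatisfiesDampedWave T (fun t => μ / (1 + t)) w₁ wt g h →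
      ContW11loc T w g → C1L1loc T w wt → MemLrloc T p w →
      (∀ s ∈ Ioc 0 τ, SupportedInBall (R + s) (w s)) → (∀ s x, 0 ≤ h s x) → (∀ᵐ x, 0 ≤ w₁ x) →
      (∀ᵐ x, 0 ≤ w 0 x) → 0 < ∫ x, w 0 x * χ x →
      C * (∫ x, w 0 x * χ x) ^ p * τ ^ ((n : ℝ) - p * (n - 1 + μ) / 2) ≤
        ∫ s in (0 : ℝ)..τ, timeCutoff (s / τ) ^ k * ∫ x, |w s x| ^ p * χ x := by
  obtain ⟨C, hC, h⟩ := exists_ae_forcing_lower_bound hn hp hμ hR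
  set e := (n : ℝ) - 1 - p * (n - 1 + μ) / 2 with he
  refine ⟨C * 4 ^ (-|e|) / 4, by positivity, fun T τ r χ hτ hτT hr hχ w₁ w wt g f hS hW hw hwp
    hsupp hh hw₁ hw0 hJ => ?_⟩
  have hτ0 : 0 < τ := by linarith
  have hlow := h T τ r χ hτ0 hτT hr hχ w₁ w wt g f hS hW hw hwp hsupp hh hw₁ hw0 hJ
  set J := ∫ x, w 0 x * χ x
  set a : ℝ → ℝ := fun s => ∫ x, |w s x| ^ p * χ x with ha
  have ha0 : ∀ s, 0 ≤ a s := fun s =>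
    integral_nonneg fun x => mul_nonneg (Real.rpow_nonneg (abs_nonneg _) _) (hχ.2.2.1 x)
  have hai : IntervalIntegrable (fun s => timeCutoff (s / τ) ^ k * a s) volume 0 τ :=
    (hwp.intervalIntegrable (by linarith) hτ0.le hτT hχ.1.continuous hχ.2.1).continuousOn_mul
      ((continuous_timeCutoff_div τ).pow k).continuousOn
  have hsub : Icc (τ / 4) (τ / 2) ⊆ Icc 0 τ := Icc_subset_Icc (by linarith) (by linarith)
  have hle : τ / 4 ≤ τ / 2 := by linarith
  have h1 : ∫ s in (τ / 4)..(τ / 2), timeCutoff (s / τ) ^ k * a s ≤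
      ∫ s in (0 : ℝ)..τ, timeCutoff (s / τ) ^ k * a s := by
    refine intervalIntegral.integral_mono_interval (by linarith) hle (by linarith)
      (ae_of_all _ fun s => mul_nonneg (pow_nonneg (timeCutoff_nonneg _) _) (ha0 s)) hai
  have h2 : ∫ _ in (τ / 4)..(τ / 2), C * J ^ p * (4 ^ (-|e|) * τ ^ e) ≤
      ∫ s in (τ / 4)..(τ / 2), timeCutoff (s / τ) ^ k * a s := by
    refine intervalIntegral.integral_mono_ae_restrict hle intervalIntegrable_const
      (hai.mono_set ?_) ?_
    · rw [uIcc_of_le hle, uIcc_of_le hτ0.le]; exact hsub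
    · filter_upwards [ae_restrict_of_ae_restrict_of_subset hsub hlow,
        ae_restrict_mem measurableSet_Icc] with s hs hsI
      have hz : timeCutoff (s / τ) = 1 :=
        timeCutoff_of_le (by rw [div_le_iff₀ hτ0]; linarith [hsI.2])
      rw [hz, one_pow, one_mul]
      refine le_trans ?_ hs
      have hs1 : 0 < 1 + s := by linarith [hsI.1]
      have h3 := rpow_neg_abs_le_rpow (L := 4) (x := (1 + s) / τ) e (by norm_num)
        (by rw [le_div_iff₀ hτ0]; linarith [hsI.1]) (by rw [div_le_iff₀ hτ0]; linarith [hsI.2])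
      rw [Real.div_rpow hs1.le hτ0.le, le_div_iff₀ (by positivity)] at h3
      gcongr
  rw [intervalIntegral.integral_const, smul_eq_mul] at h2
  have h4 : τ ^ ((n : ℝ) - p * (n - 1 + μ) / 2) = τ * τ ^ e := by
    rw [show (n : ℝ) - p * (n - 1 + μ) / 2 = 1 + e by simp only [he]; ring, Real.rpow_add hτ0,
      Real.rpow_one]
  rw [h4]
  refine le_trans (le_of_eq ?_) (h2.trans h1)
  ring

/-! ### Algebra of the coupled inequalities -/

/-- Inserting the second bound in the first leaves `x ^ (1 / (p q))` on the right, which is absorbed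
on the left because `p q > 1`. -/
lemma le_rpow_of_coupled_bounds {p q a b τ K₁ K₂ x y : ℝ} (hp : 1 < p) (hq : 1 < q) (hτ : 0 < τ)
    (hK₁ : 0 < K₁) (hK₂ : 0 < K₂) (hx : 0 ≤ x) (hy : 0 ≤ y)
    (h₁ : x ≤ K₁ * τ ^ a * y ^ (1 / q)) (h₂ : y ≤ K₂ * τ ^ b * x ^ (1 / p)) :
    x ≤ (K₁ * K₂ ^ (1 / q)) ^ (p * q / (p * q - 1)) * τ ^ ((a + b / q) * (p * q / (p * q - 1))) := by
  have hpq : 0 < p * q - 1 := by nlinarith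
  have hp0 : 0 < p := by linarith
  have hq0 : 0 < q := by linarith
  rcases hx.eq_or_lt with h0 | h0
  · rw [← h0]; positivity
  have h3 : x ≤ (K₁ * K₂ ^ (1 / q)) * τ ^ (a + b / q) * x ^ (1 / (p * q)) := by
    calc x ≤ K₁ * τ ^ a * y ^ (1 / q) := h₁
      _ ≤ K₁ * τ ^ a * (K₂ * τ ^ b * x ^ (1 / p)) ^ (1 / q) := by gcongr
      _ = _ := by
        rw [Real.mul_rpow (by positivity) (by positivity), Real.mul_rpow hK₂.le (by positivity),
          ← Real.rpow_mul hτ.le, ← Real.rpow_mul hx, Real.rpow_add hτ]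
        rw [show b * (1 / q) = b / q by ring, show 1 / p * (1 / q) = 1 / (p * q) by field_simp]
        ring
  have h4 : x ^ (1 - 1 / (p * q)) ≤ (K₁ * K₂ ^ (1 / q)) * τ ^ (a + b / q) := by
    rw [Real.rpow_sub h0, Real.rpow_one, div_le_iff₀ (by positivity)]
    exact h3
  have h5 := Real.rpow_le_rpow (by positivity) h4
    (by positivity : 0 ≤ p * q / (p * q - 1))
  rw [← Real.rpow_mul hx, Real.mul_rpow (by positivity) (by positivity), ← Real.rpow_mul hτ.le] at h5
  have : (1 - 1 / (p * q)) * (p * q / (p * q - 1)) = 1 := by field_simp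
  rwa [this, Real.rpow_one] at h5

/-- Here `I` and `J` stand for the data, `A` and `D'` for the tested forcings, `A'` and `D` for
their parts on `[τ / 2, τ]` with `D` stripped of the power weight, and `X`, `Y` for the error
integrals. Keeping the data next to the forcings lets a single elimination bound both. -/
lemma exists_coupled_decay {p q N m C₁ C₂ C₃ C₄ : ℝ} (hp : 1 < p) (hq : 1 < q)
    (hC₁ : 0 < C₁) (hC₂ : 0 < C₂) (hC₃ : 0 < C₃) (hC₄ : 0 < C₄) (hm : 0 ≤ m) :
    ∃ K, 0 < K ∧ ∀ τ A A' D D' X Y I J : ℝ, 1 ≤ τ → 0 ≤ A' → A' ≤ A → 0 ≤ D → 0 ≤ X → 0 ≤ Y →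
      0 ≤ I → 0 ≤ J →
      I + A ≤ C₁ * τ ^ (-1 : ℝ) * X → X ^ q ≤ C₂ * τ ^ (N * (q - 1)) * D →
      J + D' ≤ C₃ * τ ^ (m - 2) * Y → Y ^ p ≤ C₄ * τ ^ (N * (p - 1)) * A' →
      (τ / 2) ^ m * D ≤ D' →
      I + A ≤ K * τ ^ (N - (p * q + 2 * p) / (p * q - 1)) ∧
      J ≤ K * τ ^ (m + N - (2 * p * q + q) / (p * q - 1)) := by
  have hpq : 0 < p * q - 1 := by nlinarith
  have hp0 : 0 < p := by linarith
  have hq0 : 0 < q := by linarith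
  set K₁ := C₁ * C₂ ^ (1 / q)
  set K₂ := 2 ^ m * C₃ * C₄ ^ (1 / p)
  have hK₁ : 0 < K₁ := by positivity
  have hK₂ : 0 < K₂ := by positivity
  refine ⟨max ((K₁ * K₂ ^ (1 / q)) ^ (p * q / (p * q - 1)))
    ((K₂ * K₁ ^ (1 / p)) ^ (q * p / (q * p - 1))), lt_max_of_lt_left (by positivity),
    fun τ A A' D D' X Y I J hτ hA' hAA' hD hX hY hI hJ h1 h2 h3 h4 h5 => ?_⟩
  have hτ0 : 0 < τ := by linarith
  have root : ∀ {s Z B : ℝ}, 0 < s → 0 ≤ Z → Z ^ s ≤ B → Z ≤ B ^ (1 / s) := by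
    intro s Z B hs hZ h
    have := Real.rpow_le_rpow (Real.rpow_nonneg hZ _) h (by positivity : 0 ≤ 1 / s)
    rwa [← Real.rpow_mul hZ, mul_one_div_cancel hs.ne', Real.rpow_one] at this
  have hA : 0 ≤ A := hA'.trans hAA'
  have hx0 : 0 ≤ I + A := by linarith
  -- Rescaling `J` by the size of the weight gives a symmetric pair of inequalities for `I + A` and
  -- `y`, to be solved once for each unknown.
  set y := D + τ ^ (-m) * J with hy
  have hτm : 0 < τ ^ (-m) := by positivity
  have hy0 : 0 ≤ y := by positivity
  have hDy : D ≤ y := by rw [hy]; nlinarith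
  have e1 : I + A ≤ K₁ * τ ^ (-1 + N * (q - 1) / q) * y ^ (1 / q) := by
    have hX' := root hq0 hX h2
    calc I + A ≤ C₁ * τ ^ (-1 : ℝ) * X := h1
      _ ≤ C₁ * τ ^ (-1 : ℝ) * (C₂ * τ ^ (N * (q - 1)) * y) ^ (1 / q) := by
          gcongr
          refine hX'.trans ?_
          gcongr
      _ = _ := by
          rw [Real.mul_rpow (by positivity) hy0, Real.mul_rpow hC₂.le (by positivity),
            ← Real.rpow_mul hτ0.le, Real.rpow_add hτ0,
            show N * (q - 1) * (1 / q) = N * (q - 1) / q by ring]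
          ring
  have e2 : y ≤ K₂ * τ ^ (-2 + N * (p - 1) / p) * (I + A) ^ (1 / p) := by
    have hY' := root hp0 hY h4
    have h6 : y ≤ 2 ^ m * τ ^ (-m) * (J + D') := by
      have h7 : D ≤ 2 ^ m * τ ^ (-m) * D' := by
        rw [Real.rpow_neg hτ0.le, ← div_eq_mul_inv, div_mul_eq_mul_div,
          le_div_iff₀ (by positivity)]
        rw [Real.div_rpow hτ0.le (by norm_num), div_mul_eq_mul_div,
          div_le_iff₀ (by positivity)] at h5
        linarith
      have h8 : τ ^ (-m) * J ≤ 2 ^ m * (τ ^ (-m) * J) :=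
        le_mul_of_one_le_left (by positivity) (Real.one_le_rpow (by norm_num) hm)
      rw [hy]
      linarith
    calc y ≤ 2 ^ m * τ ^ (-m) * (J + D') := h6
      _ ≤ 2 ^ m * τ ^ (-m) * (C₃ * τ ^ (m - 2) *
          (C₄ * τ ^ (N * (p - 1)) * (I + A)) ^ (1 / p)) := by
          gcongr
          refine h3.trans ?_
          gcongr
          refine hY'.trans ?_
          gcongr
          linarith
      _ = _ := by
          rw [Real.mul_rpow (by positivity) hx0, Real.mul_rpow hC₄.le (by positivity),
            ← Real.rpow_mul hτ0.le, Real.rpow_add hτ0 (-2),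
            show N * (p - 1) * (1 / p) = N * (p - 1) / p by ring,
            show (-2 : ℝ) = -m + (m - 2) by ring, Real.rpow_add hτ0 (-m)]
          ring
  constructor
  · have := le_rpow_of_coupled_bounds hp hq hτ0 hK₁ hK₂ hx0 hy0 e1 e2
    refine this.trans ?_
    have ex : (-1 + N * (q - 1) / q + (-2 + N * (p - 1) / p) / q) * (p * q / (p * q - 1)) =
        N - (p * q + 2 * p) / (p * q - 1) := by
      have : q * p - 1 ≠ 0 := by rw [mul_comm]; exact hpq.ne'
      rw [mul_comm p q]
      field_simp
      ring
    rw [ex]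
    gcongr
    exact le_max_left _ _
  · have := le_rpow_of_coupled_bounds hq hp hτ0 hK₂ hK₁ hy0 hx0 e2 e1
    have ex : (-2 + N * (p - 1) / p + (-1 + N * (q - 1) / q) / p) * (q * p / (q * p - 1)) =
        N - (2 * p * q + q) / (p * q - 1) := by
      rw [mul_comm q p]; field_simp; ring
    rw [ex] at this
    have hJy : J ≤ τ ^ m * y := by
      rw [hy, mul_add, ← mul_assoc, ← Real.rpow_add hτ0, add_neg_cancel, Real.rpow_zero, one_mul]
      have : 0 ≤ τ ^ m * D := by positivity
      linarith
    calc J ≤ τ ^ m * y := hJy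
      _ ≤ τ ^ m * (max ((K₁ * K₂ ^ (1 / q)) ^ (p * q / (p * q - 1)))
          ((K₂ * K₁ ^ (1 / p)) ^ (q * p / (q * p - 1))) *
          τ ^ (N - (2 * p * q + q) / (p * q - 1))) := by
          gcongr
          refine this.trans ?_
          gcongr
          exact le_max_right _ _
      _ = _ := by rw [add_sub_assoc, Real.rpow_add hτ0]; ring

/-! ### Initial data and the lifespan estimate -/

lemma IsSpaceCutoff.integral_mul_eq {r R : ℝ} {χ f : E n → ℝ} (hχ : IsSpaceCutoff r χ)
    (hr : R < r) (hf : SupportedInBall R f) : ∫ x, f x * χ x = ∫ x, f x := by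
  have := hf.integral_mul_congr (φ := χ) (ψ := fun _ => 1) fun x hx =>
    hχ.2.2.2 x (mem_ball_zero_iff.2 (by linarith))
  simpa using this

lemma SupportedInBall.integrable {R : ℝ} {f : E n → ℝ} (hf : SupportedInBall R f)
    (hl : LocallyIntegrable f) : Integrable f := by
  have h := (hl.integrableOn_isCompact (isCompact_closedBall (0 : E n) R)).integrable_indicator
    Metric.isClosed_closedBall.measurableSet
  refine h.congr ?_
  filter_upwards [hf] with x hx
  by_cases hm : x ∈ Metric.closedBall (0 : E n) R
  · rw [indicator_of_mem hm]
  · rw [indicator_of_notMem hm, hx (by simpa using hm)]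

lemma NonnegNontrivial.integral_pos {R : ℝ} {f : E n → ℝ} (h : NonnegNontrivial f)
    (hf : SupportedInBall R f) (hl : LocallyIntegrable f) : 0 < ∫ x, f x := by
  have h1 : 0 ≤ ∫ x, f x := integral_nonneg_of_ae h.1
  refine h1.lt_of_ne fun h0 => h.2 ?_
  exact (integral_eq_zero_iff_of_nonneg_ae h.1 (hf.integrable hl)).1 h0.symm

lemma MemW11loc.locallyIntegrable {f : E n → ℝ} (h : MemW11loc f) : LocallyIntegrable f := by
  obtain ⟨g, hg⟩ := h
  exact hg.1

/-- The reason for the weight exponent `min μ 1`. For `μ ≤ 1` the integrating factor `(1 + s) ^ μ`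
removes the damping entirely; for `μ ≥ 1` the weight `1 + s` leaves the nonnegative constant `μ -
1`. This is the origin of `[1 - μ]₊` in `Gam`. -/
lemma damping_mul_rpow_sub {μ s : ℝ} (hs : 0 ≤ s) :
    μ / (1 + s) * (1 + s) ^ (min μ 1) - min μ 1 * (1 + s) ^ (min μ 1 - 1) = μ - min μ 1 := by
  have hs1 : 0 < 1 + s := by linarith
  rw [Real.rpow_sub_one hs1.ne']
  rcases le_total μ 1 with h | h
  · rw [min_eq_left h]; ring
  · rw [min_eq_right h, Real.rpow_one]; field_simp

lemma exists_gam_bound (hn : 1 ≤ n) {μ p q R : ℝ} (hμ : 0 ≤ μ) (hp : 1 < p) (hq : 1 < q)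
    (hR : 0 < R) {u₀ u₁ v₀ v₁ : E n → ℝ} (hu₀ : MemW11loc u₀) (hu₁ : LocallyIntegrable u₁)
    (hv₀ : MemW11loc v₀) (hv₁ : LocallyIntegrable v₁)
    (hu₀' : NonnegNontrivial u₀) (hu₁' : NonnegNontrivial u₁)
    (hv₀' : NonnegNontrivial v₀) (hv₁' : NonnegNontrivial v₁)
    (hu₀R : SupportedInBall R u₀) (hu₁R : SupportedInBall R u₁)
    (hv₀R : SupportedInBall R v₀) (hv₁R : SupportedInBall R v₁) :
    ∃ C, 0 < C ∧ ∀ ε, 0 < ε → ∀ (T : EReal) (u v : ℝ → E n → ℝ),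
      IsWeakSolution p q (fun t => μ / (1 + t)) R ε u₀ u₁ v₀ v₁ T u v →
      ∀ τ : ℝ, 1 ≤ τ → (τ : EReal) < T → ε ≤ C * τ ^ (-Gam n p q μ) := by
  have hpq : 0 < p * q - 1 := by nlinarith
  have hp0 : 0 < p := by linarith
  obtain ⟨j₁, hj₁⟩ := exists_nat_ge (2 / (p - 1))
  obtain ⟨j₂, hj₂⟩ := exists_nat_ge (2 / (q - 1))
  -- One power of the cutoff must serve Hölder with exponent `p` and with exponent `q`, since each
  -- forcing is compared with the other.
  set j := max j₁ j₂
  have hjp : (2 : ℝ) ≤ j * (p - 1) := by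
    rw [← div_le_iff₀ (by linarith)]
    exact hj₁.trans (by exact_mod_cast le_max_left _ _)
  have hjq : (2 : ℝ) ≤ j * (q - 1) := by
    rw [← div_le_iff₀ (by linarith)]
    exact hj₂.trans (by exact_mod_cast le_max_right _ _)
  set m := min μ 1 with hm
  have hm0 : 0 ≤ m := le_min hμ zero_le_one
  have hc0 : 0 ≤ μ - m := sub_nonneg.2 (min_le_left _ _)
  obtain ⟨C₁, hC₁, hu_test⟩ := exists_solution_functional_bound n (m := 0) (c := 1) (γ := -1) R j
    le_rfl zero_le_one (by norm_num) (Or.inr le_rfl)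
  obtain ⟨C₂, hC₂, hu_avg⟩ := exists_average_rpow_le n hq hR hjq
  obtain ⟨C₃, hC₃, hv_test⟩ := exists_solution_functional_bound n (m := m) (c := μ - m)
    (γ := m - 2) R j hm0 hc0 le_rfl (by
      rcases le_total μ 1 with h | h
      · left; rw [hm, min_eq_left h, sub_self]
      · right; rw [hm, min_eq_right h]; norm_num)
  obtain ⟨C₄, hC₄, hv_avg⟩ := exists_average_rpow_le n hp hR hjp
  obtain ⟨C₅, hC₅, hv_low⟩ := exists_forcing_lower_bound hn (j + 2) hp hμ hR
  obtain ⟨K, hK, halg⟩ := exists_coupled_decay (N := (n : ℝ) + 1) hp hq hC₁ hC₂ hC₃ hC₄ hm0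
  have hu₀i := hu₀'.integral_pos hu₀R hu₀.locallyIntegrable
  have hu₁i := hu₁'.integral_pos hu₁R hu₁
  have hv₀i := hv₀'.integral_pos hv₀R hv₀.locallyIntegrable
  have hv₁i := hv₁'.integral_pos hv₁R hv₁
  set I₀ := (∫ x, u₁ x) + ∫ x, u₀ x
  set J₁ := ∫ x, v₁ x
  set J₀ := ∫ x, v₀ x
  have hI₀ : 0 < I₀ := by positivity
  set B₁ := (K / (C₅ * J₀ ^ p)) ^ (1 / p)
  set B₂ := K / J₁
  set B₃ := K / I₀
  refine ⟨B₁ + B₂ + B₃, by positivity, fun ε hε T u v hsol τ hτ hτT => ?_⟩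
  obtain ⟨ut, vt, gu, gv, hWu, hCu, hLu, hWv, hCv, hLv, hsupp, hu0, hv0, hSu, hSv⟩ := hsol
  have hτ0 : 0 < τ := by linarith
  obtain ⟨χ, hχ⟩ := exists_isSpaceCutoff n (r := R + τ + 1) (by linarith)
  have hr : R + τ < R + τ + 1 := by linarith
  have hr' : R < R + τ + 1 := by linarith
  have hsu : ∀ s ∈ Ioc 0 τ, SupportedInBall (R + s) (u s) := fun s hs =>
    (hsupp s hs.1 (lt_of_le_of_lt (EReal.coe_le_coe_iff.2 hs.2) hτT)).1
  have hsv : ∀ s ∈ Ioc 0 τ, SupportedInBall (R + s) (v s) := fun s hs =>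
    (hsupp s hs.1 (lt_of_le_of_lt (EReal.coe_le_coe_iff.2 hs.2) hτT)).2
  have hdata : ∀ f : E n → ℝ, SupportedInBall R f → ∫ x, ε * f x * χ x = ε * ∫ x, f x := by
    intro f hf
    simp only [mul_assoc]
    rw [integral_const_mul, hχ.integral_mul_eq hr' hf]
  have eu0 : ∫ x, u 0 x * χ x = ε * ∫ x, u₀ x := by
    rw [← hdata u₀ hu₀R]
    refine integral_congr_ae ?_
    filter_upwards [hu0] with x hx
    rw [hx]
  have ev0 : ∫ x, v 0 x * χ x = ε * J₀ := by
    rw [← hdata v₀ hv₀R]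
    refine integral_congr_ae ?_
    filter_upwards [hv0] with x hx
    rw [hx]
  have tu := hu_test T τ _ χ hτ hτT hr hχ _ _ u ut gu _ hSu hWu hCu hsu (fun s hs => by simp)
  have tv := hv_test T τ _ χ hτ hτT hr hχ _ _ v vt gv _ hSv hWv hCv hsv
    (fun s hs => damping_mul_rpow_sub hs.1)
  have au := hu_avg T τ _ χ hτ hτT hr hχ u hCu.1 hLu hsu
  have av := hv_avg T τ _ χ hτ hτT hr hχ v hCv.1 hLv hsv
  have lv := hv_low T τ _ χ hτ hτT hr hχ _ v vt gv _ hSv hWv hCv hLv hsv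
    (fun s x => Real.rpow_nonneg (abs_nonneg _) _)
    (by filter_upwards [hv₁'.1] with x hx using mul_nonneg hε.le hx)
    (by filter_upwards [hv0, hv₀'.1] with x hx hx'; rw [hx]; exact mul_nonneg hε.le hx')
    (by rw [ev0]; positivity)
  rw [hdata u₁ hu₁R, eu0] at tu
  rw [hdata v₁ hv₁R, ev0] at tv
  rw [ev0] at lv
  simp only [timeWeight, Real.rpow_zero, one_mul] at tu
  have ha0 : ∀ s, 0 ≤ ∫ x, |v s x| ^ p * χ x := fun s =>
    integral_nonneg fun x => mul_nonneg (Real.rpow_nonneg (abs_nonneg _) _) (hχ.2.2.1 x)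
  have hd0 : ∀ s, 0 ≤ ∫ x, |u s x| ^ q * χ x := fun s =>
    integral_nonneg fun x => mul_nonneg (Real.rpow_nonneg (abs_nonneg _) _) (hχ.2.2.1 x)
  have hz0 : ∀ s, 0 ≤ timeCutoff (s / τ) ^ (j + 2) := fun s => pow_nonneg (timeCutoff_nonneg _) _
  have hzc : ContinuousOn (fun s => timeCutoff (s / τ) ^ (j + 2)) (uIcc 0 τ) :=
    ((continuous_timeCutoff_div τ).pow (j + 2)).continuousOn
  have hai := (hLv.intervalIntegrable hp0 hτ0.le hτT hχ.1.continuous hχ.2.1).continuousOn_mul hzc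
  have hdi := hLu.intervalIntegrable (by linarith) hτ0.le hτT hχ.1.continuous hχ.2.1
  have hAA' : ∫ s in (τ / 2)..τ, timeCutoff (s / τ) ^ (j + 2) * ∫ x, |v s x| ^ p * χ x ≤
      ∫ s in (0 : ℝ)..τ, timeCutoff (s / τ) ^ (j + 2) * ∫ x, |v s x| ^ p * χ x :=
    intervalIntegral.integral_mono_interval (by linarith) (by linarith) le_rfl
      (ae_of_all _ fun s => mul_nonneg (hz0 s) (ha0 s)) hai
  have hsub : uIcc (τ / 2) τ ⊆ uIcc 0 τ := by
    rw [uIcc_of_le (by linarith), uIcc_of_le hτ0.le]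
    exact Icc_subset_Icc (by linarith) le_rfl
  have hwi : IntervalIntegrable (fun s => timeWeight m (j + 2) τ s * ∫ x, |u s x| ^ q * χ x)
      volume 0 τ := hdi.continuousOn_mul (by
        rw [uIcc_of_le hτ0.le]; exact continuousOn_timeWeight m (j + 2) τ)
  have hw0 : ∀ s ∈ Icc 0 τ, 0 ≤ timeWeight m (j + 2) τ s * ∫ x, |u s x| ^ q * χ x := fun s hs =>
    mul_nonneg (mul_nonneg (Real.rpow_nonneg (by linarith [hs.1]) _) (hz0 s)) (hd0 s)
  have hDD' : (τ / 2) ^ m * ∫ s in (τ / 2)..τ, timeCutoff (s / τ) ^ (j + 2) *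
        ∫ x, |u s x| ^ q * χ x ≤
      ∫ s in (0 : ℝ)..τ, timeWeight m (j + 2) τ s * ∫ x, |u s x| ^ q * χ x := by
    rw [← intervalIntegral.integral_const_mul]
    calc _ ≤ ∫ s in (τ / 2)..τ, timeWeight m (j + 2) τ s * ∫ x, |u s x| ^ q * χ x := by
          refine intervalIntegral.integral_mono_on (by linarith)
            (((hdi.continuousOn_mul hzc).const_mul _).mono_set hsub) (hwi.mono_set hsub)
            fun s hs => ?_
          rw [timeWeight, mul_assoc]
          have : (τ / 2) ^ m ≤ (1 + s) ^ m :=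
            Real.rpow_le_rpow (by positivity) (by linarith [hs.1]) hm0
          exact mul_le_mul_of_nonneg_right this (mul_nonneg (hz0 s) (hd0 s))
      _ ≤ _ := by
          refine intervalIntegral.integral_mono_interval (by linarith) (by linarith) le_rfl ?_ hwi
          filter_upwards [ae_restrict_mem measurableSet_Ioc] with s hs
          exact hw0 s (Ioc_subset_Icc_self hs)
  obtain ⟨r₁, r₂⟩ := halg τ _ _ _ _ _ _ (ε * I₀) (ε * J₁ + (μ - m) * (ε * J₀)) hτ
    (intervalIntegral.integral_nonneg (by linarith) fun s _ => mul_nonneg (hz0 s) (ha0 s)) hAA'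
    (intervalIntegral.integral_nonneg (by linarith) fun s _ => mul_nonneg (hz0 s) (hd0 s))
    (intervalIntegral.integral_nonneg (by linarith) fun s _ =>
      mul_nonneg (abs_nonneg _) (pow_nonneg (timeCutoff_nonneg _) _))
    (intervalIntegral.integral_nonneg (by linarith) fun s _ =>
      mul_nonneg (abs_nonneg _) (pow_nonneg (timeCutoff_nonneg _) _))
    (by positivity) (by positivity) (by simp only [I₀]; linarith) au tv av hDD'
  have hA0 : 0 ≤ ∫ s in (0 : ℝ)..τ, timeCutoff (s / τ) ^ (j + 2) * ∫ x, |v s x| ^ p * χ x :=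
    intervalIntegral.integral_nonneg hτ0.le fun s _ => mul_nonneg (hz0 s) (ha0 s)
  -- The lower bound of order `ε ^ p` for the forcing against its decay; the next two bounds instead
  -- use the data of `v` and of `u` in the coupled inequalities.
  have b₁ : ε ≤ B₁ * τ ^ (-((2 + p⁻¹) / (p * q - 1) - ((n : ℝ) + μ - 1) / 2)) := by
    have h1 : C₅ * (ε * J₀) ^ p * τ ^ ((n : ℝ) - p * (n - 1 + μ) / 2) ≤
        K * τ ^ ((n : ℝ) + 1 - (p * q + 2 * p) / (p * q - 1)) := by
      have : 0 ≤ ε * I₀ := by positivity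
      linarith
    rw [Real.mul_rpow hε.le hv₀i.le, ← le_div_iff₀ (by positivity), mul_div_assoc,
      ← Real.rpow_sub hτ0] at h1
    have h2 : ε ^ p ≤ K / (C₅ * J₀ ^ p) * τ ^ (p * (-((2 + p⁻¹) / (p * q - 1)
        - ((n : ℝ) + μ - 1) / 2))) := by
      rw [div_mul_eq_mul_div, le_div_iff₀ (by positivity)]
      have ex : (n : ℝ) + 1 - (p * q + 2 * p) / (p * q - 1) - (n - p * (n - 1 + μ) / 2) =
          p * (-((2 + p⁻¹) / (p * q - 1) - ((n : ℝ) + μ - 1) / 2)) := by field_simp; ring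
      rw [ex] at h1
      linarith
    have h3 := Real.rpow_le_rpow (by positivity) h2 (by positivity : 0 ≤ 1 / p)
    rw [← Real.rpow_mul hε.le, mul_one_div_cancel hp0.ne', Real.rpow_one,
      Real.mul_rpow (by positivity) (by positivity), ← Real.rpow_mul hτ0.le] at h3
    refine h3.trans (le_of_eq ?_)
    rw [mul_right_comm, mul_one_div_cancel hp0.ne', one_mul]
  have b₂ : ε ≤ B₂ * τ ^ (-((q + 2) / (p * q - 1) - (n : ℝ) + max (1 - μ) 0)) := by
    have h1 : ε * J₁ ≤ K * τ ^ (m + (n + 1) - (2 * p * q + q) / (p * q - 1)) := by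
      have : 0 ≤ (μ - m) * (ε * J₀) := by positivity
      linarith
    have hmax : max (1 - μ) 0 = 1 - m := by
      rw [hm]
      rcases le_total μ 1 with h | h
      · rw [min_eq_left h, max_eq_left (by linarith)]
      · rw [min_eq_right h, max_eq_right (by linarith)]; ring
    have ex : m + ((n : ℝ) + 1) - (2 * p * q + q) / (p * q - 1) =
        -((q + 2) / (p * q - 1) - (n : ℝ) + max (1 - μ) 0) := by
      rw [hmax]; field_simp; ring
    rw [ex] at h1
    rw [div_mul_eq_mul_div, le_div_iff₀ hv₁i]
    exact h1
  have b₃ : ε ≤ B₃ * τ ^ (-((2 * p + 1) / (p * q - 1) - (n : ℝ))) := by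
    have ex : (n : ℝ) + 1 - (p * q + 2 * p) / (p * q - 1) =
        -((2 * p + 1) / (p * q - 1) - (n : ℝ)) := by field_simp; ring
    rw [ex] at r₁
    rw [div_mul_eq_mul_div, le_div_iff₀ hI₀]
    linarith
  have hB₁ : 0 < B₁ := by positivity
  have hB₂ : 0 < B₂ := by positivity
  have hB₃ : 0 < B₃ := by positivity
  have hτΓ : ∀ e : ℝ, 0 < τ ^ e := fun e => Real.rpow_pos_of_pos hτ0 e
  have mono : ∀ {B e : ℝ}, B ≤ B₁ + B₂ + B₃ → ε ≤ B * τ ^ e → ε ≤ (B₁ + B₂ + B₃) * τ ^ e :=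
    fun h h' => h'.trans (mul_le_mul_of_nonneg_right h (hτΓ _).le)
  rw [Gam]
  rcases max_choice (max ((2 + p⁻¹) / (p * q - 1) - ((n : ℝ) + μ - 1) / 2)
    ((q + 2) / (p * q - 1) - (n : ℝ) + max (1 - μ) 0)) ((2 * p + 1) / (p * q - 1) - (n : ℝ))
    with h | h <;> rw [h]
  · rcases max_choice ((2 + p⁻¹) / (p * q - 1) - ((n : ℝ) + μ - 1) / 2)
      ((q + 2) / (p * q - 1) - (n : ℝ) + max (1 - μ) 0) with h' | h' <;> rw [h']
    · exact mono (by linarith) b₁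
    · exact mono (by linarith) b₂
  · exact mono (by linarith) b₃

end Nakao

theorem theorem1 (n : ℕ) (hn : 1 ≤ n) (μ : ℝ) (hμ : 0 ≤ μ) (p q : ℝ) (hp : 1 < p) (hq : 1 < q)
    (R : ℝ) (hR : 0 < R) (u₀ u₁ v₀ v₁ : Nakao.E n → ℝ)
    (hu₀ : Nakao.MemW11loc u₀) (hu₁ : MeasureTheory.LocallyIntegrable u₁)
    (hv₀ : Nakao.MemW11loc v₀) (hv₁ : MeasureTheory.LocallyIntegrable v₁)
    (hu₀' : Nakao.NonnegNontrivial u₀) (hu₁' : Nakao.NonnegNontrivial u₁)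
    (hv₀' : Nakao.NonnegNontrivial v₀) (hv₁' : Nakao.NonnegNontrivial v₁)
    (hu₀R : Nakao.SupportedInBall R u₀) (hu₁R : Nakao.SupportedInBall R u₁)
    (hv₀R : Nakao.SupportedInBall R v₀) (hv₁R : Nakao.SupportedInBall R v₁)
    (hΓ : 0 < Nakao.Gam n p q μ) :
    ∃ ε₀ : ℝ, 0 < ε₀ ∧ ∃ C : ℝ, 0 < C ∧ ∀ ε : ℝ, 0 < ε → ε ≤ ε₀ →
      ∀ (T : EReal), 0 < T → ∀ u v : ℝ → Nakao.E n → ℝ,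
        Nakao.IsWeakSolution p q (fun t => μ / (1 + t)) R ε u₀ u₁ v₀ v₁ T u v →
        T < ⊤ ∧ T ≤ ((C * ε ^ (-(1 / Nakao.Gam n p q μ)) : ℝ) : EReal) := by
  obtain ⟨C, hC, hbound⟩ := Nakao.exists_gam_bound hn hμ hp hq hR hu₀ hu₁ hv₀ hv₁ hu₀' hu₁' hv₀'
    hv₁' hu₀R hu₁R hv₀R hv₁R
  set Γ := Nakao.Gam n p q μ
  -- With `ε ≤ 1`, the maximum with `1` makes the claimed lifespan bound at least `1`. A time `τ`
  -- strictly between that bound and `T` then satisfies `1 ≤ τ`, as `exists_gam_bound` requires, and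
  -- contradicts it.
  refine ⟨1, one_pos, max 1 (C ^ (1 / Γ)), by positivity, fun ε hε hε1 T _ u v hsol => ?_⟩
  have hεΓ : 1 ≤ ε ^ (-(1 / Γ)) :=
    Real.one_le_rpow_of_pos_of_le_one_of_nonpos hε hε1 (by simp [hΓ.le])
  have hB : 1 ≤ max 1 (C ^ (1 / Γ)) * ε ^ (-(1 / Γ)) :=
    one_le_mul_of_one_le_of_one_le (le_max_left _ _) hεΓ
  have hT : T ≤ ((max 1 (C ^ (1 / Γ)) * ε ^ (-(1 / Γ)) : ℝ) : EReal) := by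
    by_contra! hlt
    obtain ⟨τ, h1, h2⟩ := EReal.lt_iff_exists_real_btwn.1 hlt
    rw [EReal.coe_lt_coe_iff] at h1
    have hτ1 : 1 ≤ τ := hB.trans h1.le
    have hτ0 : 0 < τ := by linarith
    have h3 := hbound ε hε T u v hsol τ hτ1 h2
    rw [Real.rpow_neg hτ0.le, ← div_eq_mul_inv, le_div_iff₀ (by positivity)] at h3
    have h4 : τ ^ Γ ≤ C * ε⁻¹ := by
      rw [← div_eq_mul_inv, le_div_iff₀ hε]; linarith
    have h5 := Real.rpow_le_rpow (by positivity) h4 (by positivity : 0 ≤ 1 / Γ)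
    rw [← Real.rpow_mul hτ0.le, mul_one_div_cancel hΓ.ne', Real.rpow_one,
      Real.mul_rpow hC.le (by positivity), Real.inv_rpow hε.le, ← Real.rpow_neg hε.le] at h5
    have h6 : C ^ (1 / Γ) * ε ^ (-(1 / Γ)) ≤ max 1 (C ^ (1 / Γ)) * ε ^ (-(1 / Γ)) := by
      gcongr
      exact le_max_right _ _
    linarith
  exact ⟨hT.trans_lt (EReal.coe_lt_top _), hT⟩
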